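/- Let $\eta\ge 2$, let $2\le f_1<f_2<\dots<f_\eta$ be integers and let $p_1,\dots,p_\eta>0$ with $\sum_i p_i=1$. Let $D$ be the distribution that takes the value $f_i$ with probability $p_i$. For an even integer $T>0$ let $G_T$ be the random rooted tree of depth $T/2$ generated from its root $v_T$ by the following Galton–Watson process: the degrees $d_v$ of the vertices are i.i.d. with distribution $D$; the root has $d_{v_T}$ children, and every other vertex $v$ at depth less than $T/2$ has $d_v-1$ children. Let $\partial G_T$ be the set of leaves of $G_T$ (the vertices at depth $T/2$), let $\phi(v,v_T)$ be the path from $v$ to $v_T$, and put $$\Lambda_{G_T}=d_{v_T}\,\min_{v\in\partial G_T}\ \prod_{w\in\phi(v,v_T)\setminus\{v_T,v\}}(d_w-1).$$ (a) If $p_1(f_1-1)>1$, then for every $\delta>0$ there are positive constants $C_{D,\delta}$ and $C'_{D,\delta}$, depending only on $D$ and $\delta$, such that for every even $T\ge C'_{D,\delta}$ $$\mathbb P\left(\left|\frac{\log \Lambda_{G_T}}{T/2}-\log(f_1-1)\right|>\delta\right)\le e^{-C_{D,\delta}T}.$$ (b) If $p_1(f_1-1)\le 1$, let $\mu_D=\sum_{i=1}^{\eta}p_i(f_i-1)$,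 let $\beta_i=p_i(f_i-1)/\mu_D$, let $S_\eta=\{r\in\mathbb R^\eta: r_i\ge 0,\ \sum_i r_i=1\}$, let $D_{\rm KL}(r\|\beta)=\sum_i r_i\log(r_i/\beta_i)$ (with $0\log 0=0$), and let $$\mathcal R_D=\{r\in S_\eta : D_{\rm KL}(r\|\beta)\le\log\mu_D\}.$$ Then the linear function $r\mapsto\langle r,\log(f-1)\rangle=\sum_i r_i\log(f_i-1)$ has a unique minimizer $r^*$ on $\mathcal R_D$, and for every $\delta>0$ there are positive constants $C_{D,\delta}$ and $C'_{D,\delta}$, depending only on $D$ and $\delta$, such that for every even $T\ge C'_{D,\delta}$ $$\mathbb P\left(\left|\frac{\log \Lambda_{G_T}}{T/2}-\langle r^*,\log(f-1)\rangle\right|>\delta\right)\le e^{-C_{D,\delta}T}.$$ -/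

import Mathlib

open MeasureTheory ProbabilityTheory

universe u

/-! ### Rooted trees described by the degrees of their vertices

Vertices are finite words over `ℕ` (Ulam-Harris labels). The empty word is the root, and the vertex
`i :: w` is the `i`-th child of the vertex `w`. A function `d : List ℕ → ℕ` prescribes a degree for
every label; only the degrees of the labels that occur as vertices of the tree matter. -/

/-- Number of children of the vertex `w` when degrees are given by `d`: all neighbours of the root
are children, while any other vertex has one neighbour that is its parent. -/
def numChildren (d : List ℕ → ℕ) (w : List ℕ) : ℕ :=
  if w = [] then d w else d w - 1

/-- `v` is a vertex of the (infinite) tree with degrees `d`. -/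
def IsVertex (d : List ℕ → ℕ) : List ℕ → Prop
  | [] => True
  | i :: w => IsVertex d w ∧ i < numChildren d w

/-- The leaves of the tree grown to depth `n`: its vertices at distance `n` from the root. -/
def leaves (d : List ℕ → ℕ) (n : ℕ) : Set (List ℕ) :=
  {v | IsVertex d v ∧ v.length = n}

/-- The vertex set of the path from `v` to the root (the suffixes of the word `v`). -/
def pathToRoot (v : List ℕ) : Finset (List ℕ) :=
  v.tails.toFinset

/-- The product of `d w - 1` over all vertices `w` of the path from `v` to the root, both end points
excluded. -/
def pathProduct (d : List ℕ → ℕ) (v : List ℕ) : ℕ :=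
  ∏ w ∈ pathToRoot v \ {[], v}, (d w - 1)

/-- The degree of the root times the minimum, over all leaves `v` of the tree of depth `n`, of the
product of `d w - 1` over the interior vertices `w` of the path from `v` to the root. -/
noncomputable def extremalProduct (d : List ℕ → ℕ) (n : ℕ) : ℕ :=
  d [] * sInf (pathProduct d '' leaves d n)

/-- The random degrees `d v` of a Galton-Watson tree: independent over all labels `v`, and each
equal to `f i` with probability `p i`. -/
structure IsGaltonWatsonDegrees {Ω : Type*} [MeasurableSpace Ω] (P : Measure Ω) {η : ℕ}
    (f : Fin η → ℕ) (p : Fin η → ℝ) (d : List ℕ → Ω → ℕ) : Prop where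
  measurable : ∀ v, Measurable (d v)
  indep : iIndepFun d P
  law : ∀ v i, P.real {ω | d v ω = f i} = p i

/-! ### The optimization problem -/

/-- The mean number of children `∑ p i (f i - 1)`. -/
noncomputable def meanChildren {η : ℕ} (f : Fin η → ℕ) (p : Fin η → ℝ) : ℝ :=
  ∑ i, p i * ((f i : ℝ) - 1)

/-- The probability vector with entries `p i (f i - 1)`, divided by the mean number of children. -/
noncomputable def betaVec {η : ℕ} (f : Fin η → ℕ) (p : Fin η → ℝ) (i : Fin η) : ℝ :=
  p i * ((f i : ℝ) - 1) / meanChildren f p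

/-- Kullback-Leibler divergence of probability vectors `r` and `q`, where all `q i` are positive
(a term with `r i = 0` is `0`). -/
noncomputable def klDivVec {η : ℕ} (r q : Fin η → ℝ) : ℝ :=
  ∑ i, r i * Real.log (r i / q i)

/-- The probability vectors `r` with `D_KL(r ‖ β) ≤ log μ_D`. -/
def feasibleSet {η : ℕ} (f : Fin η → ℕ) (p : Fin η → ℝ) : Set (Fin η → ℝ) :=
  {r | r ∈ stdSimplex ℝ (Fin η) ∧ klDivVec r (betaVec f p) ≤ Real.log (meanChildren f p)}

/-- The linear objective `⟨r, log (f - 1)⟩`. -/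
noncomputable def objective {η : ℕ} (f : Fin η → ℕ) (r : Fin η → ℝ) : ℝ :=
  ∑ i, r i * Real.log ((f i : ℝ) - 1)

/-- `r` minimizes the objective over the feasible set. -/
def IsOptimal {η : ℕ} (f : Fin η → ℕ) (p : Fin η → ℝ) (r : Fin η → ℝ) : Prop :=
  r ∈ feasibleSet f p ∧ IsMinOn (objective f) (feasibleSet f p) r

/-! Give a vertex with `f i - 1` children the cost `log (f i - 1)`. Up to the bounded root factor,
`log Λ` is the least total cost of a path to a leaf, so this is a first-passage problem for a
branching random walk. With weights `q i = p i (f i - 1)`, the expected number of length-`n` paths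
with type frequencies `r` is, to exponential order, `exp (-n * weightEntropy q r)`. The feasible set
consists of the frequencies whose expected number does not decay exponentially, and the least cost
rate is the minimum of the linear objective there.

Lower tail: by Markov and Chernoff, the expected number of paths of cost rate `a` is bounded by the
`n`-th power of a tilted mass. Convex duality (`exists_tilt_lt_one`) makes that mass less than one
when `a` is below the optimum.

Upper tail: above the optimum, a change of measure gives a block length with more than one cheap
descendant on average (`exists_one_lt_costMean`). The process of cheap blocks is supercritical, so
cheap paths exist with probability bounded below. Every vertex has a child and some type has at
least two, so spending the first `ε n` generations on branching alone makes the failure probability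
exponentially small (`exists_costPgf_le_exp`).

All probabilities are iterates of generating functions (`costPgf`), tied to the tree by independence
of disjoint subtrees. Both halves of the theorem are instances of `exists_concentration`: in the
first, the point mass at the smallest degree is feasible and hence optimal. -/

/-! ### The optimization problem in terms of positive weights -/

section Weights

variable {ι : Type*} [Fintype ι]

/-- The relative entropy `∑ r i log (r i / q i)` of `r` with respect to positive weights `q` that
need not sum to one. -/
noncomputable def weightEntropy (q r : ι → ℝ) : ℝ :=
  ∑ i, (r i * Real.log (r i) - r i * Real.log (q i))

theorem continuous_weightEntropy (q : ι → ℝ) : Continuous (weightEntropy q) := by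
  unfold weightEntropy
  refine continuous_finsetSum _ fun i _ => ?_
  exact (Real.continuous_mul_log.comp (continuous_apply i)).sub
    ((continuous_apply i).mul continuous_const)

theorem strictConvexOn_weightEntropy (q : ι → ℝ) :
    StrictConvexOn ℝ (stdSimplex ℝ ι) (weightEntropy q) := by
  refine ⟨convex_stdSimplex ℝ ι, ?_⟩
  intro r hr s hs hrs a b ha hb hab
  have hcoord : ∀ i, (a • r + b • s) i = a * r i + b * s i := fun i => by simp
  simp only [weightEntropy, smul_eq_mul, Finset.mul_sum, ← Finset.sum_add_distrib, hcoord]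
  obtain ⟨j, hj⟩ := Function.ne_iff.1 hrs
  refine Finset.sum_lt_sum (fun i _ => ?_) ⟨j, Finset.mem_univ j, ?_⟩
  · have := Real.convexOn_mul_log.2 (hr.1 i) (hs.1 i) ha.le hb.le hab
    simp only [smul_eq_mul] at this
    linarith
  · have := Real.strictConvexOn_mul_log.2 (hr.1 j) (hs.1 j) hj ha hb hab
    simp only [smul_eq_mul] at this
    linarith

theorem continuous_sum_mul (x : ι → ℝ) : Continuous fun r : ι → ℝ => ∑ i, r i * x i := by
  fun_prop

theorem eq_single_of_sum_mul_le [DecidableEq ι] {x : ι → ℝ} {i₀ : ι}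
    (hx : ∀ i, i ≠ i₀ → x i₀ < x i) {r : ι → ℝ} (hr : r ∈ stdSimplex ℝ ι)
    (h : ∑ i, r i * x i ≤ x i₀) : r = Pi.single i₀ 1 := by
  have hx' : ∀ i, x i₀ ≤ x i := fun i => by
    by_cases hi : i = i₀
    · rw [hi]
    · exact (hx i hi).le
  have h0 : ∑ i, r i * (x i - x i₀) ≤ 0 := by
    simp only [mul_sub, Finset.sum_sub_distrib, ← Finset.sum_mul, hr.2]
    linarith
  have hnn : ∀ i ∈ Finset.univ, 0 ≤ r i * (x i - x i₀) := fun i _ =>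
    mul_nonneg (hr.1 i) (sub_nonneg.2 (hx' i))
  have hz := (Finset.sum_eq_zero_iff_of_nonneg hnn).1 (le_antisymm h0 (Finset.sum_nonneg hnn))
  have hr0 : ∀ i, i ≠ i₀ → r i = 0 := fun i hi => by
    rcases mul_eq_zero.1 (hz i (Finset.mem_univ i)) with h | h
    · exact h
    · exact absurd h (sub_pos.2 (hx i hi)).ne'
  have hr1 : r i₀ = 1 := by
    rw [← hr.2, Finset.sum_eq_single i₀ (fun i _ hi => hr0 i hi) (by simp)]
  ext i
  by_cases hi : i = i₀
  · subst hi; simp [hr1]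
  · simp [hi, hr0 i hi]

/-- A linear function with a unique smallest coefficient has a unique minimizer on a nonempty
sublevel set of the relative entropy. -/
theorem existsUnique_isMinOn_weightEntropy_le {q x : ι → ℝ} {i₀ : ι}
    (hx : ∀ i, i ≠ i₀ → x i₀ < x i)
    (hne : {r | r ∈ stdSimplex ℝ ι ∧ weightEntropy q r ≤ 0}.Nonempty) :
    ∃! r, r ∈ {r | r ∈ stdSimplex ℝ ι ∧ weightEntropy q r ≤ 0} ∧
      IsMinOn (fun r : ι → ℝ => ∑ i, r i * x i)
        {r | r ∈ stdSimplex ℝ ι ∧ weightEntropy q r ≤ 0} r := by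
  classical
  set S := {r | r ∈ stdSimplex ℝ ι ∧ weightEntropy q r ≤ 0} with hS
  have hcomp : IsCompact S :=
    (isCompact_stdSimplex ℝ ι).inter_right (isClosed_le (continuous_weightEntropy q) continuous_const)
  obtain ⟨r, hrS, hr⟩ := hcomp.exists_isMinOn hne (continuous_sum_mul x).continuousOn
  refine ⟨r, ⟨hrS, hr⟩, ?_⟩
  rintro s ⟨hsS, hs⟩
  by_contra hsr
  have hobj : ∑ i, s i * x i = ∑ i, r i * x i := le_antisymm (hs hrS) (hr hsS)
  by_cases hle : ∑ i, r i * x i ≤ x i₀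
  · exact hsr ((eq_single_of_sum_mul_le hx hsS.1 (hobj.trans_le hle)).trans
      (eq_single_of_sum_mul_le hx hrS.1 hle).symm)
  push Not at hle
  -- By strict convexity the midpoint of two minimizers has slack in the entropy constraint. It can
  -- therefore be pushed towards the vertex `i₀`, which lowers the objective.
  set m : ι → ℝ := (1 / 2 : ℝ) • s + (1 / 2 : ℝ) • r with hm
  have hmS : m ∈ stdSimplex ℝ ι :=
    convex_stdSimplex ℝ ι hsS.1 hrS.1 (by norm_num) (by norm_num) (by norm_num)
  have hmE : weightEntropy q m < 0 := by
    have := (strictConvexOn_weightEntropy q).2 hsS.1 hrS.1 hsr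
      (show (0 : ℝ) < 1 / 2 by norm_num) (show (0 : ℝ) < 1 / 2 by norm_num) (by norm_num)
    have h1 := hsS.2
    have h2 := hrS.2
    simp only [smul_eq_mul] at this
    linarith
  have hmobj : ∑ i, m i * x i = ∑ i, r i * x i := by
    have : ∑ i, m i * x i = (1 / 2) * ∑ i, s i * x i + (1 / 2) * ∑ i, r i * x i := by
      simp only [Finset.mul_sum, ← Finset.sum_add_distrib]
      refine Finset.sum_congr rfl fun i _ => ?_
      simp [hm]; ring
    rw [this, hobj]; ring
  have hcont : Continuous fun t : ℝ =>
      weightEntropy q ((1 - t) • m + t • (Pi.single i₀ 1 : ι → ℝ)) :=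
    (continuous_weightEntropy q).comp (by fun_prop)
  have hev : ∀ᶠ t in nhds (0 : ℝ),
      weightEntropy q ((1 - t) • m + t • (Pi.single i₀ 1 : ι → ℝ)) < 0 :=
    hcont.continuousAt.eventually_lt continuousAt_const (by simpa using hmE)
  obtain ⟨ε, hε, hball⟩ := Metric.eventually_nhds_iff.1 hev
  set t := min (ε / 2) 1 with ht
  have ht0 : 0 < t := lt_min (by linarith) one_pos
  have ht1 : t ≤ 1 := min_le_right _ _
  have htε : t < ε := (min_le_left _ _).trans_lt (by linarith)
  have hin : (1 - t) • m + t • (Pi.single i₀ 1 : ι → ℝ) ∈ S :=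
    ⟨convex_stdSimplex ℝ ι hmS (single_mem_stdSimplex ℝ i₀) (by linarith) ht0.le (by ring),
      (hball (by simpa [abs_of_pos ht0] using htε)).le⟩
  have := hr hin
  have hval : ∑ i, ((1 - t) • m + t • (Pi.single i₀ 1 : ι → ℝ)) i * x i =
      (1 - t) * (∑ i, r i * x i) + t * x i₀ := by
    rw [← hmobj, Finset.mul_sum]
    simp [add_mul, Finset.sum_add_distrib, mul_assoc, Pi.single_apply]
  simp only [Set.mem_ofPred_eq] at this
  rw [hval] at this
  nlinarith

/-- Weak duality is tight: below the minimum of the linear function on the sublevel set of the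
relative entropy, some exponential tilt of the weights has total mass less than one. -/
theorem exists_tilt_lt_one {q x : ι → ℝ} (hq : ∀ i, 0 < q i) (hμ : 1 ≤ ∑ i, q i) {i₀ : ι}
    (hx : ∀ i, x i₀ ≤ x i) {γ a : ℝ} (ha : a < γ)
    (hγ : ∀ r ∈ stdSimplex ℝ ι, weightEntropy q r ≤ 0 → γ ≤ ∑ i, r i * x i) :
    ∃ θ : ℝ, 0 ≤ θ ∧ ∑ i, q i * Real.exp (θ * (a - x i)) < 1 := by
  -- Below the smallest cost all exponents are negative, and letting `θ → ∞` suffices.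
  rcases lt_or_ge a (x i₀) with hax | hax
  · have hlim : Filter.Tendsto (fun θ : ℝ => ∑ i, q i * Real.exp (θ * (a - x i)))
        Filter.atTop (nhds (∑ i, q i * 0)) := by
      refine tendsto_finsetSum _ fun i _ => Filter.Tendsto.const_mul _ ?_
      refine Real.tendsto_exp_atBot.comp ?_
      exact Filter.tendsto_id.atTop_mul_const_of_neg (by linarith [hx i])
    have hev := hlim.eventually_lt_const (u := 1) (by simp)
    obtain ⟨θ, h1, h2⟩ := (hev.and (Filter.eventually_ge_atTop 0)).exists
    exact ⟨θ, h2, h1⟩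
  -- Passing from `a` to `b` makes `b - x i₀` strictly positive, which forces growth of the `i₀`
  -- term below.
  obtain ⟨b, hab, hbγ⟩ := exists_between ha
  suffices h : ∃ θ : ℝ, 0 ≤ θ ∧ ∑ i, q i * Real.exp (θ * (b - x i)) < 1 by
    obtain ⟨θ, h0, h1⟩ := h
    refine ⟨θ, h0, lt_of_le_of_lt (Finset.sum_le_sum fun i _ => ?_) h1⟩
    have := (hq i).le
    gcongr
  -- the tilted vector at parameter `θ`
  set Z : ℝ → ℝ := fun θ => ∑ i, q i * Real.exp (θ * (b - x i)) with hZ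
  have hZpos : ∀ θ, 0 < Z θ := fun θ =>
    Finset.sum_pos (fun i _ => mul_pos (hq i) (Real.exp_pos _)) ⟨i₀, Finset.mem_univ _⟩
  set r : ℝ → ι → ℝ := fun θ i => q i * Real.exp (θ * (b - x i)) / Z θ with hr
  have hrS : ∀ θ, r θ ∈ stdSimplex ℝ ι := fun θ => by
    refine ⟨fun i => (div_pos (mul_pos (hq i) (Real.exp_pos _)) (hZpos θ)).le, ?_⟩
    rw [hr]
    simp only
    rw [← Finset.sum_div]
    exact div_self (hZpos θ).ne'
  -- `ψ` is the derivative of `Z`. At a zero of `ψ` the tilted vector has mean cost exactly `b` and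
  -- entropy `-log Z`, so `1 ≤ Z` would make it feasible with objective below `γ`.
  set ψ : ℝ → ℝ := fun θ => ∑ i, q i * Real.exp (θ * (b - x i)) * (b - x i) with hψ
  have hmean : ∀ θ, ψ θ / Z θ = b - ∑ i, r θ i * x i := fun θ => by
    have h1 : ψ θ / Z θ = ∑ i, r θ i * (b - x i) := by
      rw [hψ]
      simp only
      rw [Finset.sum_div]
      exact Finset.sum_congr rfl fun i _ => by rw [hr]; ring
    rw [h1]
    simp only [mul_sub, Finset.sum_sub_distrib, ← Finset.sum_mul, (hrS θ).2, one_mul]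
  have hent : ∀ θ, weightEntropy q (r θ) = θ * (b - ∑ i, r θ i * x i) - Real.log (Z θ) := fun θ => by
    have h1 : ∀ i, r θ i * Real.log (r θ i) - r θ i * Real.log (q i) =
        θ * (r θ i * (b - x i)) - r θ i * Real.log (Z θ) := fun i => by
      have : Real.log (r θ i) = Real.log (q i) + θ * (b - x i) - Real.log (Z θ) := by
        rw [hr]
        simp only
        rw [Real.log_div (mul_pos (hq i) (Real.exp_pos _)).ne' (hZpos θ).ne',
          Real.log_mul (hq i).ne' (Real.exp_pos _).ne', Real.log_exp]
      rw [this]; ring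
    unfold weightEntropy
    simp only [h1, Finset.sum_sub_distrib, ← Finset.sum_mul, ← Finset.mul_sum, (hrS θ).2, mul_sub,
      one_mul]
  have hψ0 : ψ 0 ≤ 0 := by
    have h1 : weightEntropy q (r 0) ≤ 0 := by
      rw [hent 0]
      have : 0 ≤ Real.log (Z 0) := Real.log_nonneg (by simpa [hZ] using hμ)
      linarith
    have h2 := hγ _ (hrS 0) h1
    have h3 := hmean 0
    rw [div_eq_iff (hZpos 0).ne'] at h3
    rw [h3]
    exact mul_nonpos_of_nonpos_of_nonneg (by linarith) (hZpos 0).le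
  have hψcont : Continuous ψ := by fun_prop
  obtain ⟨Θ, hΘ0, hΘ⟩ : ∃ Θ : ℝ, 0 ≤ Θ ∧ 0 ≤ ψ Θ := by
    have hb0 : 0 < b - x i₀ := by linarith
    have hlim : Filter.Tendsto (fun θ : ℝ => q i₀ * Real.exp (θ * (b - x i₀)) * (b - x i₀))
        Filter.atTop Filter.atTop :=
      ((Real.tendsto_exp_atTop.comp
        (Filter.tendsto_id.atTop_mul_const hb0)).const_mul_atTop (hq i₀)).atTop_mul_const hb0
    obtain ⟨Θ, h1, h2⟩ := ((hlim.eventually_ge_atTop (∑ i, q i * |b - x i|)).and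
      (Filter.eventually_ge_atTop 0)).exists
    refine ⟨Θ, h2, ?_⟩
    classical
    have hterm : ∀ i, -(q i * |b - x i|) ≤ q i * Real.exp (Θ * (b - x i)) * (b - x i) := fun i => by
      have hqi := (hq i).le
      rcases le_total 0 (b - x i) with h | h
      · exact (neg_nonpos.2 (by positivity)).trans (by positivity)
      · rw [abs_of_nonpos h]
        have : Real.exp (Θ * (b - x i)) ≤ 1 :=
          Real.exp_le_one_iff.2 (mul_nonpos_of_nonneg_of_nonpos h2 h)
        nlinarith [mul_nonneg hqi (mul_nonneg (sub_nonneg.2 this) (neg_nonneg.2 h))]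
    have hsum : ∑ i, q i * Real.exp (Θ * (b - x i)) * (b - x i) =
        q i₀ * Real.exp (Θ * (b - x i₀)) * (b - x i₀) +
          ∑ i ∈ Finset.univ.erase i₀, q i * Real.exp (Θ * (b - x i)) * (b - x i) :=
      (Finset.add_sum_erase _ _ (Finset.mem_univ i₀)).symm
    have hrest : -∑ i, q i * |b - x i| ≤
        ∑ i ∈ Finset.univ.erase i₀, q i * Real.exp (Θ * (b - x i)) * (b - x i) := by
      calc -∑ i, q i * |b - x i| ≤ -∑ i ∈ Finset.univ.erase i₀, q i * |b - x i| :=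
            neg_le_neg (Finset.sum_le_sum_of_subset_of_nonneg (Finset.erase_subset _ _)
              fun i _ _ => mul_nonneg (hq i).le (abs_nonneg _))
        _ = ∑ i ∈ Finset.univ.erase i₀, -(q i * |b - x i|) := by rw [Finset.sum_neg_distrib]
        _ ≤ _ := Finset.sum_le_sum fun i _ => hterm i
    rw [hψ]
    simp only
    rw [hsum]
    linarith
  obtain ⟨θ, hθ, hθ0⟩ := intermediate_value_Icc hΘ0 hψcont.continuousOn ⟨hψ0, hΘ⟩
  refine ⟨θ, hθ.1, ?_⟩
  by_contra hge
  push Not at hge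
  have h1 := hmean θ
  rw [hθ0, zero_div] at h1
  have h2 : weightEntropy q (r θ) ≤ 0 := by
    rw [hent θ, ← h1]
    have := Real.log_nonneg hge
    linarith
  linarith [hγ _ (hrS θ) h2]

theorem div_sum_mem_stdSimplex {q : ι → ℝ} (hq : ∀ i, 0 < q i) (hμ : 0 < ∑ i, q i) :
    (fun i => q i / ∑ j, q j) ∈ stdSimplex ℝ ι :=
  ⟨fun i => (div_pos (hq i) hμ).le, by rw [← Finset.sum_div, div_self hμ.ne']⟩

theorem weightEntropy_div_sum {q : ι → ℝ} (hq : ∀ i, 0 < q i) (hμ : 0 < ∑ i, q i) :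
    weightEntropy q (fun i => q i / ∑ j, q j) = -Real.log (∑ i, q i) := by
  have h1 : ∀ i, q i / (∑ j, q j) * Real.log (q i / ∑ j, q j) -
      q i / (∑ j, q j) * Real.log (q i) = -(q i / (∑ j, q j) * Real.log (∑ j, q j)) := fun i => by
    rw [Real.log_div (hq i).ne' hμ.ne']
    ring
  unfold weightEntropy
  simp only [h1, Finset.sum_neg_distrib, ← Finset.sum_mul, (div_sum_mem_stdSimplex hq hμ).2,
    one_mul]

/-- Feasible vectors can be moved slightly so that all their entries and their slack are positive. -/
theorem exists_pos_weightEntropy_neg {q x : ι → ℝ} (hq : ∀ i, 0 < q i) (hμ : 1 < ∑ i, q i)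
    {r : ι → ℝ} (hr : r ∈ stdSimplex ℝ ι) (hr0 : weightEntropy q r ≤ 0) {a : ℝ}
    (ha : ∑ i, r i * x i < a) :
    ∃ s ∈ stdSimplex ℝ ι, (∀ i, 0 < s i) ∧ weightEntropy q s < 0 ∧ ∑ i, s i * x i < a := by
  set μ := ∑ i, q i with hμd
  have hμ0 : 0 < μ := by linarith
  -- The normalized weights are entrywise positive with entropy `-log μ < 0`; mixing in a little of
  -- them gives both properties to `r`.
  set β : ι → ℝ := fun i => q i / μ with hβ
  have hβS : β ∈ stdSimplex ℝ ι := div_sum_mem_stdSimplex hq hμ0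
  have hβE : weightEntropy q β = -Real.log μ := weightEntropy_div_sum hq hμ0
  have hlog := Real.log_pos hμ
  have hev : ∀ᶠ t in nhds (0 : ℝ), ∑ i, ((1 - t) • r + t • β) i * x i < a := by
    have hc : Continuous fun t : ℝ => ∑ i, ((1 - t) • r + t • β) i * x i :=
      (continuous_sum_mul x).comp (f := fun t : ℝ => (1 - t) • r + t • β) (by fun_prop)
    exact hc.continuousAt.eventually_lt continuousAt_const (by simpa using ha)
  obtain ⟨ε, hε, hball⟩ := Metric.eventually_nhds_iff.1 hev
  set t := min (ε / 2) 1 with ht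
  have ht0 : 0 < t := lt_min (by linarith) one_pos
  have ht1 : t ≤ 1 := min_le_right _ _
  have htε : t < ε := (min_le_left _ _).trans_lt (by linarith)
  refine ⟨(1 - t) • r + t • β, convex_stdSimplex ℝ ι hr hβS (by linarith) ht0.le (by ring),
    fun i => ?_, ?_, hball (by simpa [abs_of_pos ht0] using htε)⟩
  · have h1 : 0 < t * β i := mul_pos ht0 (div_pos (hq i) hμ0)
    have h2 : 0 ≤ (1 - t) * r i := mul_nonneg (by linarith) (hr.1 i)
    simp only [Pi.add_apply, Pi.smul_apply, smul_eq_mul]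
    linarith
  · have := (strictConvexOn_weightEntropy q).convexOn.2 hr hβS
      (show 0 ≤ 1 - t by linarith) ht0.le (by ring)
    simp only [smul_eq_mul, hβE] at this
    nlinarith [mul_nonneg (sub_nonneg.2 ht1) (neg_nonneg.2 hr0), mul_pos ht0 hlog]

end Weights

/-! ### The number of cheap descendants: generating function and mean -/

section Recursion

variable {ι : Type*} [Fintype ι]

/-- Generating function at `s` of the number of depth-`h` descendants of cost at most `c`, when a
vertex has, with probability `p i`, `k i` children and cost `x i`, and the cost of a descendant is
the sum of the costs of its proper ancestors. -/
noncomputable def costPgf (p : ι → ℝ) (k : ι → ℕ) (x : ι → ℝ) : ℕ → ℝ → ℝ → ℝ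
  | 0, c, s => if 0 ≤ c then s else 1
  | h + 1, c, s => ∑ i, p i * costPgf p k x h (c - x i) s ^ k i

/-- The mean number of depth-`h` descendants of cost at most `c`. -/
noncomputable def costMean (p : ι → ℝ) (k : ι → ℕ) (x : ι → ℝ) : ℕ → ℝ → ℝ
  | 0, c => if 0 ≤ c then 1 else 0
  | h + 1, c => ∑ i, p i * k i * costMean p k x h (c - x i)

variable {p : ι → ℝ} {k : ι → ℕ} {x : ι → ℝ}

theorem costPgf_one (hp1 : ∑ i, p i = 1) (h : ℕ) (c : ℝ) : costPgf p k x h c 1 = 1 := by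
  induction h generalizing c with
  | zero => simp [costPgf]
  | succ h ih => simp [costPgf, ih, hp1]

theorem costPgf_nonneg (hp : ∀ i, 0 ≤ p i) (h : ℕ) (c : ℝ) {s : ℝ} (hs : 0 ≤ s) :
    0 ≤ costPgf p k x h c s := by
  induction h generalizing c with
  | zero => unfold costPgf; split_ifs <;> linarith
  | succ h ih => exact Finset.sum_nonneg fun i _ => mul_nonneg (hp i) (pow_nonneg (ih _) _)

theorem costPgf_mono (hp : ∀ i, 0 ≤ p i) (h : ℕ) {c c' s s' : ℝ} (hc : c' ≤ c)
    (hs : 0 ≤ s) (hss : s ≤ s') (hs' : s' ≤ 1) :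
    costPgf p k x h c s ≤ costPgf p k x h c' s' := by
  induction h generalizing c c' with
  | zero => unfold costPgf; split_ifs <;> linarith
  | succ h ih =>
    exact Finset.sum_le_sum fun i _ => mul_le_mul_of_nonneg_left
      (pow_le_pow_left₀ (costPgf_nonneg hp _ _ hs) (ih (by linarith)) _) (hp i)

theorem costPgf_le_one (hp : ∀ i, 0 ≤ p i) (hp1 : ∑ i, p i = 1) (h : ℕ) (c : ℝ) {s : ℝ}
    (hs : 0 ≤ s) (hs1 : s ≤ 1) : costPgf p k x h c s ≤ 1 :=
  (costPgf_mono hp h le_rfl hs hs1 le_rfl).trans_eq (costPgf_one hp1 h c)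

/-- Composition of generating functions across generations. It is only an inequality, because a path
of total cost at most `c + b` need not split its budget as `c` and `b`. -/
theorem costPgf_add_le (hp : ∀ i, 0 ≤ p i) (hp1 : ∑ i, p i = 1) (h m : ℕ) (c b : ℝ) :
    costPgf p k x (h + m) (c + b) 0 ≤ costPgf p k x h c (costPgf p k x m b 0) := by
  induction h generalizing c with
  | zero =>
    rw [zero_add]
    by_cases hc : 0 ≤ c
    · simp only [costPgf, hc, if_true]
      exact costPgf_mono hp m (by linarith) le_rfl le_rfl zero_le_one
    · simp only [costPgf, hc, if_false]
      exact costPgf_le_one hp hp1 m _ le_rfl zero_le_one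
  | succ h ih =>
    rw [Nat.add_right_comm]
    refine Finset.sum_le_sum fun i _ => mul_le_mul_of_nonneg_left
      (pow_le_pow_left₀ (costPgf_nonneg hp _ _ le_rfl) ?_ _) (hp i)
    rw [add_sub_right_comm]
    exact ih _

theorem hasDerivAt_costPgf (hp1 : ∑ i, p i = 1) (h : ℕ) (c : ℝ) :
    HasDerivAt (costPgf p k x h c) (costMean p k x h c) 1 := by
  induction h generalizing c with
  | zero =>
    by_cases hc : 0 ≤ c
    · have : costPgf p k x 0 c = fun s => s := by ext s; simp [costPgf, hc]
      rw [this]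
      simpa [costMean, hc] using hasDerivAt_id' (1 : ℝ)
    · have : costPgf p k x 0 c = fun _ => 1 := by ext s; simp [costPgf, hc]
      rw [this]
      simpa [costMean, hc] using hasDerivAt_const (1 : ℝ) (1 : ℝ)
  | succ h ih =>
    have h1 : HasDerivAt (fun s => ∑ i, p i * costPgf p k x h (c - x i) s ^ k i)
        (∑ i, p i * (k i * costPgf p k x h (c - x i) 1 ^ (k i - 1) *
          costMean p k x h (c - x i))) 1 :=
      HasDerivAt.fun_sum fun i _ => ((ih (c - x i)).pow (k i)).const_mul (p i)
    refine h1.congr_deriv ?_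
    simp [costMean, costPgf_one hp1, mul_assoc]

theorem one_sub_pow_le {y : ℝ} (hy : 0 ≤ y) (n : ℕ) : 1 - y ^ n ≤ n * (1 - y) := by
  have := one_add_mul_le_pow (a := y - 1) (by linarith) n
  rw [add_sub_cancel] at this
  linarith

/-- Markov's inequality: at `s = 0` the generating function is the probability of having no cheap
descendant. -/
theorem one_sub_costPgf_le_costMean (hp : ∀ i, 0 ≤ p i) (hp1 : ∑ i, p i = 1) (h : ℕ) (c : ℝ) :
    1 - costPgf p k x h c 0 ≤ costMean p k x h c := by
  induction h generalizing c with
  | zero => unfold costPgf costMean; split_ifs <;> norm_num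
  | succ h ih =>
    calc 1 - costPgf p k x (h + 1) c 0
        = ∑ i, p i * (1 - costPgf p k x h (c - x i) 0 ^ k i) := by
          simp only [costPgf, mul_sub, Finset.sum_sub_distrib, mul_one, hp1]
      _ ≤ ∑ i, p i * k i * costMean p k x h (c - x i) := by
          refine Finset.sum_le_sum fun i _ => ?_
          rw [mul_assoc]
          refine mul_le_mul_of_nonneg_left ?_ (hp i)
          exact (one_sub_pow_le (costPgf_nonneg hp _ _ le_rfl) _).trans
            (mul_le_mul_of_nonneg_left (ih _) (Nat.cast_nonneg _))

/-- Chernoff's bound: the indicator of cost at most `c` is dominated by `exp (θ * (c - cost))`,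
whose mean factors over generations. -/
theorem costMean_le_exp (hp : ∀ i, 0 ≤ p i) {θ : ℝ} (hθ : 0 ≤ θ) (a : ℝ) (h : ℕ) (c : ℝ) :
    costMean p k x h c ≤
      Real.exp (θ * (c - a * h)) * (∑ i, p i * k i * Real.exp (θ * (a - x i))) ^ h := by
  induction h generalizing c with
  | zero =>
    unfold costMean
    split_ifs with hc
    · simpa using Real.one_le_exp (mul_nonneg hθ hc)
    · simpa using (Real.exp_pos _).le
  | succ h ih =>
    set Z := ∑ i, p i * k i * Real.exp (θ * (a - x i)) with hZ
    calc costMean p k x (h + 1) c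
        ≤ ∑ i, p i * k i * (Real.exp (θ * (c - x i - a * h)) * Z ^ h) :=
          Finset.sum_le_sum fun i _ => mul_le_mul_of_nonneg_left (ih _)
            (mul_nonneg (hp i) (Nat.cast_nonneg _))
      _ = ∑ i, p i * k i * Real.exp (θ * (a - x i)) *
            (Real.exp (θ * (c - a * (h + 1 : ℕ))) * Z ^ h) := by
          refine Finset.sum_congr rfl fun i _ => ?_
          have : Real.exp (θ * (c - x i - a * h)) =
              Real.exp (θ * (a - x i)) * Real.exp (θ * (c - a * (h + 1 : ℕ))) := by
            rw [← Real.exp_add]; congr 1; push_cast; ring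
          rw [this]; ring
      _ = _ := by rw [← Finset.sum_mul, ← hZ, pow_succ]; ring

/-- The many-to-one formula: the mean as a sum over words of types, ready for a change of measure.
-/
theorem costMean_eq_sum (h : ℕ) (c : ℝ) : costMean p k x h c =
    ∑ w : Fin h → ι, if ∑ j, x (w j) ≤ c then ∏ j, p (w j) * k (w j) else 0 := by
  induction h generalizing c with
  | zero => simp [costMean]
  | succ h ih =>
    rw [← (Fin.consEquiv fun _ : Fin (h + 1) => ι).sum_comp, Fintype.sum_prod_type]
    simp only [costMean, ih, Finset.mul_sum]
    refine Finset.sum_congr rfl fun i _ => Finset.sum_congr rfl fun w _ => ?_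
    simp only [Fin.consEquiv_apply, Fin.sum_univ_succ, Fin.prod_univ_succ, Fin.cons_zero,
      Fin.cons_succ, mul_ite, mul_zero, le_sub_iff_add_le']

/-- A strict sub-mean deviation has exponential moment less than one. -/
theorem exists_expMoment_lt_one {r y : ι → ℝ} (hr : ∑ i, r i = 1) {b : ℝ}
    (hb : ∑ i, r i * y i < b) : ∃ θ : ℝ, 0 < θ ∧ ∑ i, r i * Real.exp (θ * (y i - b)) < 1 := by
  have hd : HasDerivAt (fun θ : ℝ => ∑ i, r i * Real.exp (θ * (y i - b)))
      (∑ i, r i * (y i - b)) 0 := by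
    refine HasDerivAt.fun_sum fun i _ => HasDerivAt.const_mul (r i) ?_
    simpa using ((hasDerivAt_id (0 : ℝ)).mul_const (y i - b)).exp
  have hneg : ∑ i, r i * (y i - b) < 0 := by
    simp only [mul_sub, Finset.sum_sub_distrib, ← Finset.sum_mul, hr]
    linarith
  have hev := ((hasDerivAt_iff_tendsto_slope.1 hd).mono_left
    (nhdsWithin_mono (0 : ℝ) fun t (ht : t ∈ Set.Ioi (0 : ℝ)) => ht.ne')).eventually_lt_const hneg
  obtain ⟨θ, h1, h2⟩ := (hev.and self_mem_nhdsWithin).exists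
  refine ⟨θ, h2, ?_⟩
  rw [slope_def_field] at h1
  have h3 : (0 : ℝ) < θ - 0 := by simpa using h2
  rw [div_lt_iff₀ h3] at h1
  simp [hr] at h1
  exact h1

/-- Some generation has more than one cheap descendant in the mean, at every cost rate above that of
a positive vector with negative relative entropy. -/
theorem exists_one_lt_costMean (hq : ∀ i, 0 < p i * k i) {r : ι → ℝ}
    (hr : r ∈ stdSimplex ℝ ι) (hrpos : ∀ i, 0 < r i)
    (hE : weightEntropy (fun i => p i * k i) r < 0) {a : ℝ} (ha : ∑ i, r i * x i < a) :
    ∃ L : ℕ, 0 < L ∧ 1 < costMean p k x L (a * L) := by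
  set q : ι → ℝ := fun i => p i * k i with hqd
  -- The log-likelihood ratio of `r` against `q`; its mean under `r` is the relative entropy, hence
  -- negative.
  set y : ι → ℝ := fun i => Real.log (r i / q i) with hy
  have hy0 : ∑ i, r i * y i < 0 := by
    refine lt_of_eq_of_lt (Finset.sum_congr rfl fun i _ => ?_) hE
    rw [hy]
    simp only
    rw [Real.log_div (hrpos i).ne' (hq i).ne', mul_sub]
  obtain ⟨b, hb1, hb2⟩ := exists_between hy0
  obtain ⟨θ₁, hθ₁, hρ₁⟩ := exists_expMoment_lt_one hr.2 hb1
  obtain ⟨θ₂, hθ₂, hρ₂⟩ := exists_expMoment_lt_one hr.2 ha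
  set ρ₁ := ∑ i, r i * Real.exp (θ₁ * (y i - b)) with hρ₁d
  set ρ₂ := ∑ i, r i * Real.exp (θ₂ * (x i - a)) with hρ₂d
  have hnn : ∀ (θ : ℝ) (z : ι → ℝ), 0 ≤ ∑ i, r i * Real.exp (θ * z i) := fun θ z =>
    Finset.sum_nonneg fun i _ => mul_nonneg (hrpos i).le (Real.exp_pos _).le
  -- Under the product measure of `r`, words with `∑ y > b * L` or `∑ x > a * L` have mass at most
  -- `ρ₁ ^ L + ρ₂ ^ L`. On the remaining words the `q`-mass is at least `exp (-b * L)` times the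
  -- `r`-mass, and `b < 0`. The comparison is made word by word.
  have hkey : ∀ L : ℕ, Real.exp (-b * L) * (1 - ρ₁ ^ L - ρ₂ ^ L) ≤ costMean p k x L (a * L) := by
    intro L
    have hone : (1 : ℝ) = (∑ i, r i) ^ L := by rw [hr.2, one_pow]
    rw [hone, hρ₁d, hρ₂d, Fintype.sum_pow, Fintype.sum_pow, Fintype.sum_pow, costMean_eq_sum,
      ← Finset.sum_sub_distrib, ← Finset.sum_sub_distrib, Finset.mul_sum]
    refine Finset.sum_le_sum fun w _ => ?_
    have hR : 0 < ∏ j, r (w j) := Finset.prod_pos fun j _ => hrpos _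
    have hexp : ∀ (θ e : ℝ) (z : ι → ℝ), ∏ j, r (w j) * Real.exp (θ * (z (w j) - e)) =
        (∏ j, r (w j)) * Real.exp (θ * (∑ j, z (w j) - e * L)) := fun θ e z => by
      rw [Finset.prod_mul_distrib, ← Real.exp_sum, ← Finset.mul_sum, Finset.sum_sub_distrib]
      simp [mul_comm]
    rw [hexp, hexp]
    have hprod : ∏ j, q (w j) = (∏ j, r (w j)) * Real.exp (-∑ j, y (w j)) := by
      rw [← Finset.sum_neg_distrib, Real.exp_sum, ← Finset.prod_mul_distrib]
      refine Finset.prod_congr rfl fun j _ => ?_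
      rw [hy]
      simp only
      rw [Real.exp_neg, Real.exp_log (div_pos (hrpos _) (hq _)), inv_div,
        mul_div_cancel₀ _ (hrpos _).ne']
    have e1 := Real.exp_pos (θ₁ * (∑ j, y (w j) - b * L))
    have e2 := Real.exp_pos (θ₂ * (∑ j, x (w j) - a * L))
    have e3 := Real.exp_pos (-b * L)
    by_cases hx : ∑ j, x (w j) ≤ a * L
    · rw [if_pos hx]
      change _ ≤ ∏ j, q (w j)
      rw [hprod]
      by_cases hyb : ∑ j, y (w j) ≤ b * L
      · calc _ ≤ Real.exp (-b * L) * ∏ j, r (w j) := by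
              refine mul_le_mul_of_nonneg_left ?_ e3.le
              nlinarith [mul_pos hR e1, mul_pos hR e2]
          _ ≤ _ := by
              rw [mul_comm]
              refine mul_le_mul_of_nonneg_left (Real.exp_le_exp.2 ?_) hR.le
              linarith
      · have : 1 ≤ Real.exp (θ₁ * (∑ j, y (w j) - b * L)) :=
          Real.one_le_exp (mul_nonneg hθ₁.le (by linarith))
        refine le_trans (mul_nonpos_of_nonneg_of_nonpos e3.le ?_)
          (mul_pos hR (Real.exp_pos _)).le
        nlinarith [mul_pos hR e2, mul_nonneg hR.le (sub_nonneg.2 this)]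
    · rw [if_neg hx]
      have : 1 ≤ Real.exp (θ₂ * (∑ j, x (w j) - a * L)) :=
        Real.one_le_exp (mul_nonneg hθ₂.le (by linarith))
      refine mul_nonpos_of_nonneg_of_nonpos e3.le ?_
      nlinarith [mul_pos hR e1, mul_nonneg hR.le (sub_nonneg.2 this)]
  have hlim1 : Filter.Tendsto (fun L : ℕ => 1 - ρ₁ ^ L - ρ₂ ^ L) Filter.atTop (nhds 1) := by
    have h1 := tendsto_pow_atTop_nhds_zero_of_lt_one (hnn θ₁ fun i => y i - b) hρ₁
    have h2 := tendsto_pow_atTop_nhds_zero_of_lt_one (hnn θ₂ fun i => x i - a) hρ₂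
    simpa using (h1.const_sub 1).sub h2
  have hlim2 : Filter.Tendsto (fun L : ℕ => Real.exp (-b * L)) Filter.atTop Filter.atTop :=
    Real.tendsto_exp_atTop.comp
      (tendsto_natCast_atTop_atTop.const_mul_atTop (neg_pos.2 hb2))
  obtain ⟨L, ⟨h1, h2⟩, h3⟩ := (((hlim2.atTop_mul_pos one_pos hlim1).eventually_gt_atTop 1).and
    (Filter.eventually_gt_atTop 0) |>.and (Filter.eventually_gt_atTop 0)).exists
  exact ⟨L, h3, h1.trans_le (hkey L)⟩

/-- If a block of generations is supercritical, the event of having a cheap descendant after many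
blocks has probability bounded below. -/
theorem exists_costPgf_block_le (hp : ∀ i, 0 ≤ p i) (hp1 : ∑ i, p i = 1) {L : ℕ} {c : ℝ}
    (hL : 1 < costMean p k x L c) :
    ∃ s : ℝ, 0 ≤ s ∧ s < 1 ∧ ∀ j : ℕ, costPgf p k x (L * j) (c * j) 0 ≤ s := by
  -- The derivative at the fixed point `1` is the mean, which exceeds one, so the graph lies below
  -- the diagonal just left of `1`. Iterates from `0` never pass such an `s`.
  have hev := ((hasDerivAt_iff_tendsto_slope.1
    (hasDerivAt_costPgf (k := k) (x := x) hp1 L c)).mono_left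
    (nhdsWithin_mono (1 : ℝ) fun t (ht : t ∈ Set.Iio (1 : ℝ)) => ht.ne)).eventually_const_lt hL
  have hev2 : ∀ᶠ s in nhdsWithin (1 : ℝ) (Set.Iio 1), (0 : ℝ) ≤ s :=
    nhdsWithin_le_nhds (Ici_mem_nhds one_pos)
  obtain ⟨s, ⟨h1, h2⟩, h3⟩ := (hev.and hev2 |>.and self_mem_nhdsWithin).exists
  have h3' : s < 1 := h3
  have hfix : costPgf p k x L c s ≤ s := by
    rw [slope_def_field, costPgf_one hp1, lt_div_iff_of_neg (by linarith)] at h1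
    linarith
  refine ⟨s, h2, h3', fun j => ?_⟩
  induction j with
  | zero => simpa [costPgf] using h2
  | succ j ih =>
    have e1 : L * (j + 1) = L + L * j := by ring
    have e2 : c * ((j + 1 : ℕ) : ℝ) = c + c * j := by push_cast; ring
    rw [e1, e2]
    exact (costPgf_add_le hp hp1 _ _ _ _).trans
      ((costPgf_mono hp L le_rfl (costPgf_nonneg hp _ _ le_rfl) ih h3'.le).trans hfix)

/-- The extra budget `X` pays for one vertex of any type, so all its children must fail with budget
`c`. There is always one child, and with probability `p l` at least two: `A` becomes at most `(1 - p
l) * A + p l * A ^ 2`. -/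
theorem costPgf_succ_le (hp : ∀ i, 0 ≤ p i) (hp1 : ∑ i, p i = 1) (hk : ∀ i, 1 ≤ k i) {l : ι}
    (hl : 2 ≤ k l) {X : ℝ} (hX : ∀ i, x i ≤ X) (h : ℕ) (c : ℝ) :
    costPgf p k x (h + 1) (c + X) 0 ≤
      costPgf p k x h c 0 * (1 - p l * (1 - costPgf p k x h c 0)) := by
  classical
  set A := costPgf p k x h c 0 with hA
  have hA0 : 0 ≤ A := costPgf_nonneg hp _ _ le_rfl
  have hA1 : A ≤ 1 := costPgf_le_one hp hp1 _ _ le_rfl zero_le_one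
  have hle : ∀ i, costPgf p k x h (c + X - x i) 0 ^ k i ≤ A ^ k i := fun i =>
    pow_le_pow_left₀ (costPgf_nonneg hp _ _ le_rfl)
      (costPgf_mono hp h (by linarith [hX i]) le_rfl le_rfl zero_le_one) _
  calc costPgf p k x (h + 1) (c + X) 0
      ≤ ∑ i, (p i * A - if i = l then p l * (A * (1 - A)) else 0) := by
        refine Finset.sum_le_sum fun i _ => ?_
        split_ifs with hi
        · subst hi
          have : A ^ k i ≤ A ^ 2 := pow_le_pow_of_le_one hA0 hA1 hl
          have := mul_le_mul_of_nonneg_left ((hle i).trans this) (hp i)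
          refine this.trans (le_of_eq ?_)
          ring
        · have : A ^ k i ≤ A ^ 1 := pow_le_pow_of_le_one hA0 hA1 (hk i)
          rw [pow_one] at this
          simpa using mul_le_mul_of_nonneg_left ((hle i).trans this) (hp i)
    _ = _ := by
        rw [Finset.sum_sub_distrib, ← Finset.sum_mul, hp1]
        simp
        ring

/-- The bound by `s` is carried along in the induction to keep the contraction factor uniform. -/
theorem costPgf_add_le_pow (hp : ∀ i, 0 ≤ p i) (hp1 : ∑ i, p i = 1) (hk : ∀ i, 1 ≤ k i) {l : ι}
    (hl : 2 ≤ k l) {X : ℝ} (hX : ∀ i, x i ≤ X) {h : ℕ} {c s : ℝ} (hs : s ≤ 1)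
    (hc : costPgf p k x h c 0 ≤ s) (t : ℕ) :
    costPgf p k x (h + t) (c + X * t) 0 ≤ s ∧
      costPgf p k x (h + t) (c + X * t) 0 ≤ (1 - p l * (1 - s)) ^ t := by
  have hpl : p l ≤ 1 := hp1 ▸ Finset.single_le_sum (fun i _ => hp i) (Finset.mem_univ l)
  have hρ : 0 ≤ 1 - p l * (1 - s) := by
    have hA0 : 0 ≤ s := (costPgf_nonneg hp _ _ le_rfl).trans hc
    nlinarith [hp l]
  induction t with
  | zero =>
    refine ⟨by simpa using hc, ?_⟩
    simpa using costPgf_le_one hp hp1 h c le_rfl zero_le_one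
  | succ t ih =>
    have e : c + X * ((t + 1 : ℕ) : ℝ) = c + X * t + X := by push_cast; ring
    have hstep := costPgf_succ_le hp hp1 hk hl hX (h + t) (c + X * t)
    rw [e, ← add_assoc]
    set A := costPgf p k x (h + t) (c + X * t) 0 with hA
    have hA0 : 0 ≤ A := costPgf_nonneg hp _ _ le_rfl
    have h1 : 1 - p l * (1 - A) ≤ 1 - p l * (1 - s) := by
      have := mul_le_mul_of_nonneg_left ih.1 (hp l)
      linarith
    have h2 := hstep.trans (mul_le_mul_of_nonneg_left h1 hA0)
    refine ⟨h2.trans (le_trans (mul_le_of_le_one_right hA0 ?_) ih.1),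
      h2.trans ((mul_le_mul_of_nonneg_right ih.2 hρ).trans_eq (pow_succ _ _).symm)⟩
    nlinarith [mul_nonneg (hp l) (sub_nonneg.2 hs)]

/-- Exponentially small upper tail of the smallest cost of a descendant. -/
theorem exists_costPgf_le_exp (hp : ∀ i, 0 < p i) (hp1 : ∑ i, p i = 1) (hk : ∀ i, 1 ≤ k i) {l : ι}
    (hl : 2 ≤ k l) {L : ℕ} (hL0 : 0 < L) {a b : ℝ} (ha : 0 ≤ a) (hab : a < b)
    (hL : 1 < costMean p k x L (a * L)) :
    ∃ C : ℝ, 0 < C ∧ ∃ N : ℕ, ∀ n : ℕ, N ≤ n → costPgf p k x n (b * n) 0 ≤ Real.exp (-C * n) := by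
  have hp' : ∀ i, 0 ≤ p i := fun i => (hp i).le
  obtain ⟨s, hs0, hs1, hs⟩ := exists_costPgf_block_le hp' hp1 hL
  obtain ⟨X, hX0, hX⟩ : ∃ X : ℝ, 0 < X ∧ ∀ i, x i ≤ X := by
    refine ⟨∑ i, |x i| + 1, by positivity, fun i => ?_⟩
    have := Finset.single_le_sum (f := fun i => |x i|) (fun i _ => abs_nonneg _) (Finset.mem_univ i)
    have := le_abs_self (x i)
    linarith
  set ρ := 1 - p l * (1 - s) with hρ
  have hpl : p l ≤ 1 := hp1 ▸ Finset.single_le_sum (fun i _ => hp' i) (Finset.mem_univ l)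
  have hρ1 : ρ < 1 := by have := mul_pos (hp l) (sub_pos.2 hs1); linarith
  have hρ0' : 0 ≤ ρ := by nlinarith [hp l]
  -- a number in `(0, 1)` above `ρ`
  set σ := (ρ + 1) / 2 with hσ
  have hσ0 : 0 < σ := by linarith
  have hσ1 : σ < 1 := by linarith
  have hρσ : ρ ≤ σ := by linarith
  -- About `ε n` generations at full price `X` use at most half of the slack `(b - a) * n`.
  set ε := min ((b - a) / (2 * X)) 1 with hε
  have hε0 : 0 < ε := lt_min (div_pos (by linarith) (by linarith)) one_pos
  have hε1 : ε ≤ 1 := min_le_right _ _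
  have hεX : ε * X ≤ (b - a) / 2 := by
    have := mul_le_mul_of_nonneg_right (min_le_left ((b - a) / (2 * X)) 1) hX0.le
    refine this.trans_eq ?_
    field_simp
  have hlogσ : 0 < -Real.log σ := neg_pos.2 (Real.log_neg hσ0 hσ1)
  -- The first threshold gives `⌊ε n⌋ ≥ ε n / 2`. The second lets the other half of the slack pay
  -- for the fewer than `L` generations left over by the blocks.
  refine ⟨-Real.log σ * ε / 2, by positivity, ⌈2 / ε⌉₊ + ⌈2 * (L * X) / (b - a)⌉₊, fun n hn => ?_⟩
  have hn1 : 2 / ε ≤ n := (Nat.le_ceil _).trans (by exact_mod_cast (Nat.le_add_right _ _).trans hn)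
  have hn2 : 2 * (L * X) / (b - a) ≤ n :=
    (Nat.le_ceil _).trans (by exact_mod_cast (Nat.le_add_left _ _).trans hn)
  rw [div_le_iff₀ hε0] at hn1
  rw [div_le_iff₀ (by linarith)] at hn2
  set e := ⌊ε * n⌋₊ with he
  have hn0 : (0 : ℝ) ≤ n := Nat.cast_nonneg n
  have he1 : (e : ℝ) ≤ ε * n := Nat.floor_le (by positivity)
  have he2 : ε * n - 1 < e := Nat.sub_one_lt_floor _
  have hen : e ≤ n := by
    have : (e : ℝ) ≤ n := he1.trans (by nlinarith)
    exact_mod_cast this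
  set j := (n - e) / L with hj
  set t := (n - e) % L with ht
  have htL : (t : ℝ) ≤ L := by exact_mod_cast (Nat.mod_lt _ hL0).le
  have hdecomp : n = L * j + (t + e) := by
    have : L * j + t = n - e := Nat.div_add_mod (n - e) L
    omega
  have hjn : (L : ℝ) * j ≤ n := by
    have : L * j ≤ n := by omega
    exact_mod_cast this
  have hcost : a * L * j + X * ((t + e : ℕ) : ℝ) ≤ b * n := by
    push_cast
    have h1 : a * L * j ≤ a * n := by
      rw [mul_assoc]; exact mul_le_mul_of_nonneg_left hjn ha
    have h2 : X * t ≤ L * X := by nlinarith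
    have h3 : X * e ≤ (b - a) / 2 * n := by
      calc X * e ≤ X * (ε * n) := mul_le_mul_of_nonneg_left he1 hX0.le
        _ = ε * X * n := by ring
        _ ≤ _ := mul_le_mul_of_nonneg_right hεX hn0
    nlinarith
  calc costPgf p k x n (b * n) 0
      ≤ costPgf p k x n (a * L * j + X * ((t + e : ℕ) : ℝ)) 0 :=
        costPgf_mono hp' n hcost le_rfl le_rfl zero_le_one
    _ ≤ ρ ^ (t + e) := by
        conv_lhs => rw [hdecomp]
        exact (costPgf_add_le_pow hp' hp1 hk hl hX hs1.le (hs j) (t + e)).2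
    _ ≤ σ ^ (t + e) := pow_le_pow_left₀ hρ0' hρσ _
    _ ≤ σ ^ e := pow_le_pow_of_le_one hσ0.le hσ1.le (Nat.le_add_left _ _)
    _ = Real.exp (Real.log σ * e) := by
        rw [mul_comm, Real.exp_nat_mul, Real.exp_log hσ0]
    _ ≤ _ := by
        refine Real.exp_le_exp.2 ?_
        have : ε * n / 2 ≤ e := by linarith
        nlinarith

end Recursion

/-! ### Costs of descendants in a tree with given degrees -/

section Tree

/-- All depth-`h` descendants of the vertex `w` have cost larger than `c`, where the cost of a
descendant `u` is the sum of `log (d v - 1)` over the vertices `v` from `w` up to the parent of `u`,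
and every vertex `v` counts `d v - 1` children. -/
def AllCostly (d : List ℕ → ℕ) : ℕ → ℝ → List ℕ → Prop
  | 0, c, _ => c < 0
  | h + 1, c, w => ∀ i < d w - 1, AllCostly d h (c - Real.log ((d w - 1 : ℕ) : ℝ)) (i :: w)

/-- `u ++ w` is a descendant of `w`, when every vertex `v` has `d v - 1` children. -/
def IsDescendant (d : List ℕ → ℕ) : List ℕ → List ℕ → Prop
  | [], _ => True
  | i :: u, w => IsDescendant d u w ∧ i < d (u ++ w) - 1

/-- The cost of the descendant `u ++ w` of `w`. -/
noncomputable def descendantCost (d : List ℕ → ℕ) : List ℕ → List ℕ → ℝ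
  | [], _ => 0
  | _ :: u, w => descendantCost d u w + Real.log ((d (u ++ w) - 1 : ℕ) : ℝ)

variable {d : List ℕ → ℕ}

/-- Recursion on words peels off the last generation, while `AllCostly` peels off the first; this
converts between the two. -/
theorem isDescendant_append_singleton (u w : List ℕ) (i : ℕ) :
    IsDescendant d (u ++ [i]) w ↔ i < d w - 1 ∧ IsDescendant d u (i :: w) := by
  induction u with
  | nil => simp [IsDescendant]
  | cons j u ih => simp [IsDescendant, ih, and_assoc]

theorem descendantCost_append_singleton (u w : List ℕ) (i : ℕ) :
    descendantCost d (u ++ [i]) w =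
      descendantCost d u (i :: w) + Real.log ((d w - 1 : ℕ) : ℝ) := by
  induction u with
  | nil => simp [descendantCost]
  | cons j u ih =>
    simp only [List.cons_append, descendantCost, ih, List.append_assoc, List.nil_append]
    ring

theorem allCostly_iff (h : ℕ) (c : ℝ) (w : List ℕ) : AllCostly d h c w ↔
    ∀ u : List ℕ, u.length = h → IsDescendant d u w → c < descendantCost d u w := by
  induction h generalizing c w with
  | zero => simp [AllCostly, List.length_eq_zero_iff, IsDescendant, descendantCost]
  | succ h ih =>
    simp only [AllCostly, ih]
    constructor
    · intro H u hu hd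
      obtain rfl | ⟨u, i, rfl⟩ := u.eq_nil_or_concat
      · simp at hu
      rw [List.concat_eq_append] at hu hd ⊢
      rw [isDescendant_append_singleton] at hd
      rw [descendantCost_append_singleton]
      have := H i hd.1 u (by simpa using hu) hd.2
      linarith
    · intro H i hi u hu hd
      have := H (u ++ [i]) (by simpa using hu) ((isDescendant_append_singleton _ _ _).2 ⟨hi, hd⟩)
      rw [descendantCost_append_singleton] at this
      linarith

/-- Only the root has as many children as its degree; below a child of the root the tree is
homogeneous. -/
theorem isVertex_append_singleton (u : List ℕ) (i : ℕ) :
    IsVertex d (u ++ [i]) ↔ i < d [] ∧ IsDescendant d u [i] := by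
  induction u with
  | nil => simp [IsVertex, IsDescendant, numChildren]
  | cons j u ih => simp [IsVertex, IsDescendant, numChildren, ih, and_assoc]

theorem pathProduct_singleton (i : ℕ) : pathProduct d [i] = 1 := by
  unfold pathProduct
  refine Finset.prod_eq_one fun w hw => ?_
  simp only [pathToRoot, Finset.mem_sdiff, List.mem_toFinset, List.mem_tails,
    Finset.mem_insert, Finset.mem_singleton, not_or, List.suffix_cons_iff, List.suffix_nil] at hw
  tauto

theorem pathProduct_cons {v : List ℕ} (hv : v ≠ []) (j : ℕ) :
    pathProduct d (j :: v) = (d v - 1) * pathProduct d v := by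
  have hset : pathToRoot (j :: v) \ {[], j :: v} = insert v (pathToRoot v \ {[], v}) := by
    ext w
    simp only [pathToRoot, Finset.mem_sdiff, List.mem_toFinset, List.mem_tails, Finset.mem_insert,
      Finset.mem_singleton, not_or, List.suffix_cons_iff]
    constructor
    · rintro ⟨h1 | h1, h2, h3⟩
      · exact absurd h1 h3
      · by_cases hw : w = v
        · exact Or.inl hw
        · exact Or.inr ⟨h1, h2, hw⟩
    · rintro (rfl | ⟨h1, h2, h3⟩)
      · exact ⟨Or.inr List.suffix_rfl, hv, fun h => by simpa using congrArg List.length h⟩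
      · refine ⟨Or.inr h1, h2, fun h => ?_⟩
        have := h1.length_le
        rw [h] at this
        simp at this
  unfold pathProduct
  rw [hset, Finset.prod_insert (by simp)]

theorem pathProduct_append_singleton_pos (hd : ∀ v, 2 ≤ d v) (u : List ℕ) (i : ℕ) :
    0 < pathProduct d (u ++ [i]) := by
  refine Finset.prod_pos fun w _ => ?_
  have := hd w
  omega

theorem log_pathProduct_append_singleton (hd : ∀ v, 2 ≤ d v) (u : List ℕ) (i : ℕ) :
    Real.log (pathProduct d (u ++ [i]) : ℝ) = descendantCost d u [i] := by
  induction u with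
  | nil => simp [pathProduct_singleton, descendantCost]
  | cons j u ih =>
    have h1 : ((d (u ++ [i]) - 1 : ℕ) : ℝ) ≠ 0 := by
      have := hd (u ++ [i])
      exact_mod_cast (by omega : d (u ++ [i]) - 1 ≠ 0)
    have h2 : (pathProduct d (u ++ [i]) : ℝ) ≠ 0 := by
      exact_mod_cast (pathProduct_append_singleton_pos hd u i).ne'
    rw [List.cons_append, pathProduct_cons (by simp), Nat.cast_mul, Real.log_mul h1 h2, ih,
      descendantCost, add_comm]

/-- Needed because `sInf ∅ = 0` in `ℕ`: with a leaf present the infimum is attained. -/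
theorem exists_leaf (hd : ∀ v, 2 ≤ d v) (n : ℕ) : ∃ v, v ∈ leaves d n := by
  refine ⟨List.replicate n 0, ?_, by simp⟩
  induction n with
  | zero => simp [IsVertex]
  | succ n ih =>
    refine ⟨ih, ?_⟩
    unfold numChildren
    have := hd (List.replicate n 0)
    split_ifs <;> omega

/-- The minimum of the path products over the leaves. -/
noncomputable def minPathProduct (d : List ℕ → ℕ) (n : ℕ) : ℕ :=
  sInf (pathProduct d '' leaves d n)

theorem exists_leaf_pathProduct_eq (hd : ∀ v, 2 ≤ d v) (n : ℕ) :
    ∃ v ∈ leaves d n, pathProduct d v = minPathProduct d n := by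
  obtain ⟨v, hv⟩ := exists_leaf hd n
  exact Nat.sInf_mem (⟨_, v, hv, rfl⟩ : (pathProduct d '' leaves d n).Nonempty)

theorem eq_append_singleton_of_mem_leaves {n : ℕ} {v : List ℕ} (hv : v ∈ leaves d (n + 1)) :
    ∃ u i, v = u ++ [i] ∧ u.length = n ∧ i < d [] ∧ IsDescendant d u [i] := by
  obtain rfl | ⟨u, i, rfl⟩ := v.eq_nil_or_concat
  · exact absurd hv.2 (by simp)
  · rw [List.concat_eq_append] at hv ⊢
    have h1 := hv.1
    have h2 := hv.2
    rw [isVertex_append_singleton] at h1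
    exact ⟨u, i, rfl, by simpa using h2, h1⟩

theorem minPathProduct_pos (hd : ∀ v, 2 ≤ d v) (n : ℕ) : 0 < minPathProduct d (n + 1) := by
  obtain ⟨v, hv, hvm⟩ := exists_leaf_pathProduct_eq hd (n + 1)
  obtain ⟨u, i, rfl, -⟩ := eq_append_singleton_of_mem_leaves hv
  exact hvm ▸ pathProduct_append_singleton_pos hd u i

theorem lt_log_minPathProduct_iff (hd : ∀ v, 2 ≤ d v) (n : ℕ) (c : ℝ) :
    c < Real.log (minPathProduct d (n + 1) : ℝ) ↔ ∀ i < d [], AllCostly d n c [i] := by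
  simp only [allCostly_iff]
  constructor
  · intro H i hi u hu hdesc
    rw [← log_pathProduct_append_singleton hd]
    refine H.trans_le (Real.log_le_log (by exact_mod_cast minPathProduct_pos hd n) ?_)
    have : u ++ [i] ∈ leaves d (n + 1) :=
      ⟨(isVertex_append_singleton u i).2 ⟨hi, hdesc⟩, by simpa using hu⟩
    exact_mod_cast Nat.sInf_le (⟨_, this, rfl⟩ : _ ∈ pathProduct d '' leaves d (n + 1))
  · intro H
    obtain ⟨v, hv, hvm⟩ := exists_leaf_pathProduct_eq hd (n + 1)
    obtain ⟨u, i, rfl, hu, hi, hdesc⟩ := eq_append_singleton_of_mem_leaves hv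
    rw [← hvm, log_pathProduct_append_singleton hd]
    exact H i hi u hu hdesc

end Tree

/-! ### Probabilities -/

section Probability

section Sigma

variable {Ω : Type*} {d : List ℕ → Ω → ℕ}

/-- The σ-algebra generated by the degrees of `w` and of all labels below it. -/
abbrev subtreeSigma (d : List ℕ → Ω → ℕ) (w : List ℕ) : MeasurableSpace Ω :=
  ⨆ v ∈ {v | w <:+ v}, MeasurableSpace.comap (d v) inferInstance

theorem subtreeSigma_cons_le (w : List ℕ) (i : ℕ) : subtreeSigma d (i :: w) ≤ subtreeSigma d w :=
  biSup_mono fun _ hv => (List.suffix_cons i w).trans hv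

theorem comap_le_subtreeSigma (w : List ℕ) :
    MeasurableSpace.comap (d w) inferInstance ≤ subtreeSigma d w :=
  le_biSup (fun v => MeasurableSpace.comap (d v) inferInstance)
    (show w ∈ {v | w <:+ v} from List.suffix_rfl)

/-- Measurability with respect to the subtree at `w` is what yields independence across siblings. -/
theorem measurableSet_allCostly (h : ℕ) (c : ℝ) (w : List ℕ) :
    MeasurableSet[subtreeSigma d w] {ω | AllCostly (fun v => d v ω) h c w} := by
  induction h generalizing c w with
  | zero => simp only [AllCostly]; exact @MeasurableSet.const _ (subtreeSigma d w) _
  | succ h ih =>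
    have hset : {ω | AllCostly (fun v => d v ω) (h + 1) c w} =
        ⋃ m : ℕ, (d w ⁻¹' {m} ∩ ⋂ i ∈ Finset.range (m - 1),
          {ω | AllCostly (fun v => d v ω) h (c - Real.log ((m - 1 : ℕ) : ℝ)) (i :: w)}) := by
      ext ω
      simp [AllCostly]
    rw [hset]
    refine MeasurableSet.iUnion fun m => MeasurableSet.inter ?_ ?_
    · exact comap_le_subtreeSigma w _ ⟨{m}, measurableSet_singleton m, rfl⟩
    · exact Finset.measurableSet_biInter _ fun i _ => subtreeSigma_cons_le w i _ (ih _ _)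

end Sigma

variable {Ω : Type*} [MeasurableSpace Ω] {P : Measure Ω}
  {η : ℕ} {f : Fin η → ℕ} {p : Fin η → ℝ} {d : List ℕ → Ω → ℕ}

theorem subtreeSigma_le (hd : ∀ v, Measurable (d v)) (w : List ℕ) :
    subtreeSigma d w ≤ ‹MeasurableSpace Ω› :=
  iSup₂_le fun v _ => (hd v).comap_le

/-- The label `w` and the subtrees at its children involve disjoint sets of labels, whose degrees
are independent. -/
theorem measureReal_inter_biInter_children (hm : ∀ v, Measurable (d v)) (hi : iIndepFun d P)
    {w : List ℕ} {F : Set Ω} (hF : MeasurableSet[MeasurableSpace.comap (d w) inferInstance] F)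
    {E : ℕ → Set Ω} (hE : ∀ i, MeasurableSet[subtreeSigma d (i :: w)] (E i)) (K : ℕ) :
    P.real (F ∩ ⋂ i ∈ Finset.range K, E i) = P.real F * ∏ i ∈ Finset.range K, P.real (E i) := by
  induction K with
  | zero => simp
  | succ K ih =>
    set S : Set (List ℕ) := {v | v = w ∨ ∃ i < K, (i :: w) <:+ v} with hS
    have hdisj : Disjoint S {v | (K :: w) <:+ v} := by
      refine Set.disjoint_left.2 ?_
      rintro v (rfl | ⟨i, hiK, hiv⟩) hKv
      · simpa using List.IsSuffix.length_le hKv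
      · have h := (List.suffix_of_suffix_length_le hiv hKv (by simp)).eq_of_length (by simp)
        simp only [List.cons.injEq] at h
        omega
    have hind := indep_iSup_of_disjoint (fun v => (hm v).comap_le)
      ((iIndepFun_iff_iIndep (fun _ : List ℕ => (inferInstance : MeasurableSpace ℕ)) d P).1 hi) hdisj
    have hmeas : MeasurableSet[⨆ v ∈ S, MeasurableSpace.comap (d v) inferInstance]
        (F ∩ ⋂ i ∈ Finset.range K, E i) := by
      refine MeasurableSet.inter ?_ (Finset.measurableSet_biInter _ fun i hiK => ?_)
      · exact le_biSup (fun v => MeasurableSpace.comap (d v) (inferInstance : MeasurableSpace ℕ))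
          (show w ∈ S from Or.inl rfl) _ hF
      · have hle : subtreeSigma d (i :: w) ≤
            ⨆ v ∈ S, MeasurableSpace.comap (d v) inferInstance :=
          biSup_mono fun v hv => Or.inr ⟨i, Finset.mem_range.1 hiK, hv⟩
        exact hle _ (hE i)
    have h := (Indep_iff _ _ P).1 hind _ _ hmeas (hE K)
    have hset : F ∩ ⋂ i ∈ Finset.range (K + 1), E i = (F ∩ ⋂ i ∈ Finset.range K, E i) ∩ E K := by
      ext ω
      simp only [Set.mem_inter_iff, Set.mem_iInter, Finset.mem_range, Nat.lt_succ_iff_lt_or_eq]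
      constructor
      · rintro ⟨h1, h2⟩
        exact ⟨⟨h1, fun i hi => h2 i (Or.inl hi)⟩, h2 K (Or.inr rfl)⟩
      · rintro ⟨⟨h1, h2⟩, h3⟩
        refine ⟨h1, ?_⟩
        rintro i (hi | rfl)
        · exact h2 i hi
        · exact h3
    rw [hset, Finset.prod_range_succ, ← mul_assoc, ← ih]
    simp only [Measure.real, h, ENNReal.toReal_mul]

variable [IsProbabilityMeasure P]

theorem IsGaltonWatsonDegrees.ae_mem_range (hd : IsGaltonWatsonDegrees P f p d)
    (hf : Function.Injective f) (hp1 : ∑ i, p i = 1) (w : List ℕ) :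
    ∀ᵐ ω ∂P, ∃ i, d w ω = f i := by
  have hmeas : ∀ m, MeasurableSet {ω | d w ω = m} := fun m =>
    hd.measurable w (measurableSet_singleton m)
  have h1 : P.real (⋃ i ∈ (Finset.univ : Finset (Fin η)), {ω | d w ω = f i}) = 1 := by
    rw [measureReal_biUnion_finset ?_ fun i _ => hmeas _]
    · simpa [hd.law] using hp1
    · intro i _ j _ hij
      refine Set.disjoint_left.2 fun ω h1 h2 => hij (hf ?_)
      exact (Eq.symm h1).trans h2
  have h2 : P (⋃ i ∈ (Finset.univ : Finset (Fin η)), {ω | d w ω = f i}) = 1 := by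
    rwa [Measure.real, ENNReal.toReal_eq_one_iff] at h1
  have h3 := (mem_ae_iff_prob_eq_one
    (Finset.measurableSet_biUnion Finset.univ fun i _ => hmeas (f i))).2 h2
  filter_upwards [h3] with ω hω
  simpa using hω

/-- Conditioning on the degree at `w`. The free function `K` serves both the root (`K = id`) and the
other vertices (`K m = m - 1`). -/
theorem IsGaltonWatsonDegrees.measureReal_forall_children (hd : IsGaltonWatsonDegrees P f p d)
    (hf : Function.Injective f) (hp1 : ∑ i, p i = 1) (w : List ℕ) (K : ℕ → ℕ)
    {E : ℕ → ℕ → Set Ω} (hE : ∀ m j, MeasurableSet[subtreeSigma d (j :: w)] (E m j))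
    {A : Fin η → ℝ} (hA : ∀ i j, P.real (E (f i) j) = A i) :
    P.real {ω | ∀ j < K (d w ω), ω ∈ E (d w ω) j} = ∑ i, p i * A i ^ K (f i) := by
  set B := {ω | ∀ j < K (d w ω), ω ∈ E (d w ω) j} with hB
  have hpiece : ∀ i, {ω | d w ω = f i} ∩ B =
      {ω | d w ω = f i} ∩ ⋂ j ∈ Finset.range (K (f i)), E (f i) j := fun i => by
    ext ω
    simp only [hB, Set.mem_inter_iff, Set.mem_ofPred_eq, Set.mem_iInter, Finset.mem_range]
    refine and_congr_right fun h => ?_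
    rw [h]
  have hmeas : ∀ i, MeasurableSet ({ω | d w ω = f i} ∩ B) := fun i => by
    rw [hpiece]
    refine (hd.measurable w (measurableSet_singleton (f i))).inter
      (Finset.measurableSet_biInter _ fun j _ => ?_)
    exact subtreeSigma_le hd.measurable _ _ (hE _ _)
  have hae : B =ᵐ[P] ⋃ i ∈ (Finset.univ : Finset (Fin η)), ({ω | d w ω = f i} ∩ B) := by
    filter_upwards [hd.ae_mem_range hf hp1 w] with ω hω
    apply propext
    change ω ∈ B ↔ ω ∈ ⋃ i ∈ (Finset.univ : Finset (Fin η)), ({ω | d w ω = f i} ∩ B)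
    simp only [Set.mem_iUnion, Finset.mem_univ, Set.mem_inter_iff, exists_prop, true_and]
    exact ⟨fun h => hω.imp fun i hi => ⟨hi, h⟩, fun ⟨_, _, h⟩ => h⟩
  rw [measureReal_congr hae, measureReal_biUnion_finset ?_ fun i _ => hmeas i]
  · refine Finset.sum_congr rfl fun i _ => ?_
    rw [hpiece, measureReal_inter_biInter_children hd.measurable hd.indep (w := w)
      (F := {ω | d w ω = f i}) ⟨{f i}, measurableSet_singleton _, rfl⟩ (hE (f i)), hd.law]
    simp [hA]
  · intro i _ j _ hij
    refine Set.disjoint_left.2 fun ω h1 h2 => hij (hf ?_)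
    exact (Eq.symm h1.1).trans h2.1

theorem IsGaltonWatsonDegrees.measureReal_allCostly (hd : IsGaltonWatsonDegrees P f p d)
    (hf : Function.Injective f) (hp1 : ∑ i, p i = 1) (h : ℕ) (c : ℝ) (w : List ℕ) :
    P.real {ω | AllCostly (fun v => d v ω) h c w} =
      costPgf p (fun i => f i - 1) (fun i => Real.log ((f i - 1 : ℕ) : ℝ)) h c 0 := by
  induction h generalizing c w with
  | zero =>
    by_cases hc : 0 ≤ c
    · simp [AllCostly, costPgf, hc, not_lt.2 hc]
    · simp [AllCostly, costPgf, hc, not_le.1 hc]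
  | succ h ih =>
    exact hd.measureReal_forall_children hf hp1 w (fun m => m - 1)
      (E := fun m j => {ω | AllCostly (fun v => d v ω) h (c - Real.log ((m - 1 : ℕ) : ℝ)) (j :: w)})
      (fun m j => measurableSet_allCostly _ _ _) (fun i j => ih _ _)

theorem IsGaltonWatsonDegrees.lt_log_minPathProduct_ae_eq
    (hd : IsGaltonWatsonDegrees P f p d) (hf : Function.Injective f) (hf2 : ∀ i, 2 ≤ f i)
    (hp1 : ∑ i, p i = 1) (n : ℕ) (c : ℝ) :
    {ω | c < Real.log (minPathProduct (fun v => d v ω) (n + 1) : ℝ)} =ᵐ[P]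
      {ω | ∀ j < d [] ω, ω ∈ {ω | AllCostly (fun v => d v ω) n c [j]}} := by
  filter_upwards [ae_all_iff.2 (hd.ae_mem_range hf hp1)] with ω hω
  refine propext (lt_log_minPathProduct_iff (fun v => ?_) n c)
  obtain ⟨i, hi⟩ := hω v
  rw [hi]
  exact hf2 i

/-- The description by `AllCostly` holds almost surely, so null measurability is what it gives; this
suffices for taking complements in the lower tail. -/
theorem IsGaltonWatsonDegrees.nullMeasurableSet_lt_log_minPathProduct
    (hd : IsGaltonWatsonDegrees P f p d) (hf : Function.Injective f) (hf2 : ∀ i, 2 ≤ f i)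
    (hp1 : ∑ i, p i = 1) (n : ℕ) (c : ℝ) :
    NullMeasurableSet {ω | c < Real.log (minPathProduct (fun v => d v ω) (n + 1) : ℝ)} P := by
  refine NullMeasurableSet.congr (MeasurableSet.nullMeasurableSet ?_)
    (hd.lt_log_minPathProduct_ae_eq hf hf2 hp1 n c).symm
  have hset : {ω | ∀ j < d [] ω, ω ∈ {ω | AllCostly (fun v => d v ω) n c [j]}} =
      ⋂ j : ℕ, ((d [] ⁻¹' Set.Ioi j)ᶜ ∪ {ω | AllCostly (fun v => d v ω) n c [j]}) := by
    ext ω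
    simp [imp_iff_not_or]
  rw [hset]
  exact MeasurableSet.iInter fun j => ((hd.measurable [] measurableSet_Ioi).compl).union
    (subtreeSigma_le hd.measurable _ _ (measurableSet_allCostly n c [j]))

theorem IsGaltonWatsonDegrees.measureReal_lt_log_minPathProduct
    (hd : IsGaltonWatsonDegrees P f p d) (hf : Function.Injective f) (hf2 : ∀ i, 2 ≤ f i)
    (hp1 : ∑ i, p i = 1) (n : ℕ) (c : ℝ) :
    P.real {ω | c < Real.log (minPathProduct (fun v => d v ω) (n + 1) : ℝ)} =
      ∑ i, p i *
        costPgf p (fun i => f i - 1) (fun i => Real.log ((f i - 1 : ℕ) : ℝ)) n c 0 ^ f i :=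
  (measureReal_congr (hd.lt_log_minPathProduct_ae_eq hf hf2 hp1 n c)).trans
    (hd.measureReal_forall_children hf hp1 [] id
      (E := fun _ j => {ω | AllCostly (fun v => d v ω) n c [j]})
      (fun _ _ => measurableSet_allCostly _ _ _)
      (fun _ _ => hd.measureReal_allCostly hf hp1 _ _ _))

theorem IsGaltonWatsonDegrees.ae_log_extremalProduct (hd : IsGaltonWatsonDegrees P f p d)
    (hf : Function.Injective f) (hf2 : ∀ i, 2 ≤ f i) (hp1 : ∑ i, p i = 1) {M : ℕ}
    (hM : ∀ i, f i ≤ M) (n : ℕ) :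
    ∀ᵐ ω ∂P, Real.log (minPathProduct (fun v => d v ω) (n + 1) : ℝ) ≤
        Real.log (extremalProduct (fun v => d v ω) (n + 1) : ℝ) ∧
      Real.log (extremalProduct (fun v => d v ω) (n + 1) : ℝ) ≤
        Real.log M + Real.log (minPathProduct (fun v => d v ω) (n + 1) : ℝ) := by
  filter_upwards [ae_all_iff.2 (hd.ae_mem_range hf hp1)] with ω hω
  have h2 : ∀ v, 2 ≤ d v ω := fun v => by
    obtain ⟨i, hi⟩ := hω v
    rw [hi]
    exact hf2 i
  have h3 : d [] ω ≤ M := by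
    obtain ⟨i, hi⟩ := hω []
    rw [hi]
    exact hM i
  have hroot : (2 : ℝ) ≤ d [] ω := by exact_mod_cast h2 []
  have hroot' : (d [] ω : ℝ) ≤ M := by exact_mod_cast h3
  have hmin : (minPathProduct (fun v => d v ω) (n + 1) : ℝ) ≠ 0 := by
    exact_mod_cast (minPathProduct_pos h2 n).ne'
  have heq : Real.log (extremalProduct (fun v => d v ω) (n + 1) : ℝ) =
      Real.log (d [] ω) + Real.log (minPathProduct (fun v => d v ω) (n + 1) : ℝ) := by
    rw [← Real.log_mul (by linarith) hmin, ← Nat.cast_mul]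
    rfl
  rw [heq]
  have h4 : 0 ≤ Real.log (d [] ω) := Real.log_nonneg (by linarith)
  have h5 : Real.log (d [] ω) ≤ Real.log M := Real.log_le_log (by linarith) hroot'
  constructor <;> linarith

end Probability

/-! ### The optimization problem of the statement -/

section Optimization

variable {η : ℕ} {f : Fin η → ℕ} {p : Fin η → ℝ}

/-- The weights `p i (f i - 1)`. -/
noncomputable def childWeight (f : Fin η → ℕ) (p : Fin η → ℝ) (i : Fin η) : ℝ :=
  p i * ((f i - 1 : ℕ) : ℝ)

/-- The costs `log (f i - 1)`. -/
noncomputable def logCost (f : Fin η → ℕ) (i : Fin η) : ℝ :=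
  Real.log ((f i - 1 : ℕ) : ℝ)

theorem cast_sub_one (hf2 : ∀ i, 2 ≤ f i) (i : Fin η) : ((f i - 1 : ℕ) : ℝ) = (f i : ℝ) - 1 := by
  rw [Nat.cast_sub (by linarith [hf2 i]), Nat.cast_one]

theorem childWeight_pos (hf2 : ∀ i, 2 ≤ f i) (hp : ∀ i, 0 < p i) (i : Fin η) :
    0 < childWeight f p i := by
  refine mul_pos (hp i) ?_
  have := hf2 i
  exact_mod_cast (by omega : 0 < f i - 1)

theorem sum_childWeight (hf2 : ∀ i, 2 ≤ f i) : ∑ i, childWeight f p i = meanChildren f p :=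
  Finset.sum_congr rfl fun i _ => by rw [childWeight, cast_sub_one hf2]

theorem one_lt_sum_childWeight (hf2 : ∀ i, 2 ≤ f i) (hp : ∀ i, 0 < p i) (hp1 : ∑ i, p i = 1)
    {l : Fin η} (hl : 2 ≤ f l - 1) : 1 < ∑ i, childWeight f p i := by
  rw [← hp1]
  refine Finset.sum_lt_sum (fun i _ => ?_) ⟨l, Finset.mem_univ l, ?_⟩
  · refine le_mul_of_one_le_right (hp i).le ?_
    have := hf2 i
    exact_mod_cast (by omega : 1 ≤ f i - 1)
  · refine lt_mul_of_one_lt_right (hp l) ?_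
    exact_mod_cast (by omega : 1 < f l - 1)

theorem objective_eq (hf2 : ∀ i, 2 ≤ f i) (r : Fin η → ℝ) :
    objective f r = ∑ i, r i * logCost f i :=
  Finset.sum_congr rfl fun i _ => by rw [logCost, cast_sub_one hf2]

/-- Normalizing the weights shifts the entropy by `log μ_D`, so the constraint of the statement
becomes `weightEntropy ≤ 0`. -/
theorem klDivVec_betaVec (hf2 : ∀ i, 2 ≤ f i) (hp : ∀ i, 0 < p i) (hμ : 0 < meanChildren f p)
    {r : Fin η → ℝ} (hr : r ∈ stdSimplex ℝ (Fin η)) :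
    klDivVec r (betaVec f p) = weightEntropy (childWeight f p) r + Real.log (meanChildren f p) := by
  have h1 : Real.log (meanChildren f p) = ∑ i, r i * Real.log (meanChildren f p) := by
    rw [← Finset.sum_mul, hr.2, one_mul]
  rw [h1, weightEntropy, ← Finset.sum_add_distrib]
  refine Finset.sum_congr rfl fun i _ => ?_
  rcases eq_or_ne (r i) 0 with h0 | h0
  · simp [h0]
  · have hq := (childWeight_pos hf2 hp i).ne'
    have hβ : betaVec f p i = childWeight f p i / meanChildren f p := by
      rw [betaVec, childWeight, cast_sub_one hf2]
    rw [hβ, Real.log_div h0 (div_ne_zero hq hμ.ne'), Real.log_div hq hμ.ne']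
    ring

theorem feasibleSet_eq (hf2 : ∀ i, 2 ≤ f i) (hp : ∀ i, 0 < p i) (hμ : 0 < meanChildren f p) :
    feasibleSet f p =
      {r | r ∈ stdSimplex ℝ (Fin η) ∧ weightEntropy (childWeight f p) r ≤ 0} := by
  ext r
  refine and_congr_right fun hr => ?_
  rw [klDivVec_betaVec hf2 hp hμ hr]
  constructor <;> intro h <;> linarith

theorem logCost_lt (hf : StrictMono f) (hf2 : ∀ i, 2 ≤ f i) {i j : Fin η} (hij : i < j) :
    logCost f i < logCost f j := by
  have h1 := hf2 i
  have h2 := hf hij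
  refine Real.log_lt_log ?_ ?_
  · exact_mod_cast (by omega : 0 < f i - 1)
  · exact_mod_cast (by omega : f i - 1 < f j - 1)

theorem logCost_nonneg (i : Fin η) : 0 ≤ logCost f i := Real.log_natCast_nonneg _

theorem existsUnique_isOptimal (hf : StrictMono f) (hf2 : ∀ i, 2 ≤ f i) (hp : ∀ i, 0 < p i)
    (hμ : 1 < meanChildren f p) {i₀ : Fin η} (hi₀ : ∀ i, i ≠ i₀ → i₀ < i) :
    ∃! r, IsOptimal f p r := by
  have hμ' : 1 < ∑ i, childWeight f p i := by rwa [sum_childWeight hf2]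
  have hμ0 : 0 < ∑ i, childWeight f p i := by linarith
  have hq := childWeight_pos hf2 hp
  have hobj : objective f = fun r => ∑ i, r i * logCost f i := funext (objective_eq hf2)
  unfold IsOptimal
  rw [feasibleSet_eq hf2 hp (by linarith), hobj]
  refine existsUnique_isMinOn_weightEntropy_le (i₀ := i₀)
    (fun i hi => logCost_lt hf hf2 (hi₀ i hi))
    ⟨_, div_sum_mem_stdSimplex hq hμ0, ?_⟩
  rw [weightEntropy_div_sum hq hμ0]
  have := Real.log_pos hμ'
  linarith

theorem objective_single (i₀ : Fin η) :
    objective f (Pi.single i₀ 1) = Real.log ((f i₀ : ℝ) - 1) := by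
  unfold objective
  rw [Finset.sum_eq_single i₀ (fun i _ hi => by simp [hi]) (by simp)]
  simp

/-- The point mass at `i₀` minimizes the objective on the whole simplex, and its entropy is `-log (p
i₀ * (f i₀ - 1))`. -/
theorem isOptimal_single (hf : StrictMono f) (hf2 : ∀ i, 2 ≤ f i) (hp : ∀ i, 0 < p i)
    (hμ : 0 < meanChildren f p) {i₀ : Fin η} (hi₀ : ∀ i, i ≠ i₀ → i₀ < i)
    (h1 : 1 ≤ p i₀ * ((f i₀ : ℝ) - 1)) : IsOptimal f p (Pi.single i₀ 1) := by
  unfold IsOptimal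
  rw [feasibleSet_eq hf2 hp hμ]
  refine ⟨⟨single_mem_stdSimplex ℝ i₀, ?_⟩, fun r hr => ?_⟩
  · unfold weightEntropy
    rw [Finset.sum_eq_single i₀ (fun i _ hi => by simp [hi]) (by simp)]
    simpa [childWeight, cast_sub_one hf2] using Real.log_nonneg h1
  · change objective f (Pi.single i₀ 1) ≤ objective f r
    rw [objective_single, objective_eq hf2, ← cast_sub_one hf2]
    calc logCost f i₀ = ∑ i, r i * logCost f i₀ := by rw [← Finset.sum_mul, hr.1.2, one_mul]
      _ ≤ _ := Finset.sum_le_sum fun i _ => by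
        refine mul_le_mul_of_nonneg_left ?_ (hr.1.1 i)
        by_cases hi : i = i₀
        · rw [hi]
        · exact (logCost_lt hf hf2 (hi₀ i hi)).le

end Optimization

/-! ### Concentration -/

section Concentration

variable {η : ℕ} {f : Fin η → ℕ} {p : Fin η → ℝ}

theorem exists_upper_tail (hf : StrictMono f) (hf2 : ∀ i, 2 ≤ f i) (hp : ∀ i, 0 < p i)
    (hp1 : ∑ i, p i = 1) {l : Fin η} (hl : 2 ≤ f l - 1) {r : Fin η → ℝ} (hr : IsOptimal f p r)
    {b : ℝ} (hb : objective f r < b) :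
    ∃ C : ℝ, 0 < C ∧ ∃ N : ℕ, ∀ n : ℕ, N ≤ n →
      ∀ (Ω : Type u) [MeasurableSpace Ω] (P : Measure Ω) [IsProbabilityMeasure P]
        (d : List ℕ → Ω → ℕ), IsGaltonWatsonDegrees P f p d →
        P.real {ω | b * n < Real.log (minPathProduct (fun v => d v ω) (n + 1) : ℝ)} ≤
          Real.exp (-C * n) := by
  have hμ := one_lt_sum_childWeight hf2 hp hp1 hl
  have hμ0 : 0 < meanChildren f p := by rw [← sum_childWeight hf2]; linarith
  have hrf := hr.1
  rw [feasibleSet_eq hf2 hp hμ0] at hrf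
  obtain ⟨a, hra, hab⟩ := exists_between hb
  have ha0 : 0 ≤ a := by
    refine le_trans ?_ hra.le
    rw [objective_eq hf2]
    exact Finset.sum_nonneg fun i _ => mul_nonneg (hrf.1.1 i) (logCost_nonneg i)
  rw [objective_eq hf2] at hra
  obtain ⟨s, hsS, hspos, hsE, hsa⟩ :=
    exists_pos_weightEntropy_neg (childWeight_pos hf2 hp) hμ hrf.1 hrf.2 hra
  obtain ⟨L, hL0, hL⟩ :=
    exists_one_lt_costMean (k := fun i => f i - 1) (childWeight_pos hf2 hp) hsS hspos hsE hsa
  obtain ⟨C, hC, N, hN⟩ := exists_costPgf_le_exp hp hp1 (k := fun i => f i - 1)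
    (fun i => by have := hf2 i; omega) hl hL0 ha0 hab hL
  refine ⟨C, hC, N, fun n hn Ω _ P _ d hd => ?_⟩
  rw [hd.measureReal_lt_log_minPathProduct hf.injective hf2 hp1]
  refine le_trans ?_ (hN n hn)
  have hp' : ∀ i, 0 ≤ p i := fun i => (hp i).le
  have hA0 := costPgf_nonneg (k := fun i => f i - 1) (x := logCost f) hp' n (b * n) le_rfl
  have hA1 := costPgf_le_one (k := fun i => f i - 1) (x := logCost f) hp' hp1 n (b * n) le_rfl
    zero_le_one
  -- All children of the root must fail; keeping just one of them loses nothing in the rate.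
  calc _ ≤ ∑ i, p i * costPgf p (fun i => f i - 1) (logCost f) n (b * n) 0 :=
        Finset.sum_le_sum fun i _ => mul_le_mul_of_nonneg_left
          (pow_le_of_le_one hA0 hA1 (by have := hf2 i; omega)) (hp' i)
    _ = _ := by rw [← Finset.sum_mul, hp1, one_mul]

theorem exists_lower_tail (hf : StrictMono f) (hf2 : ∀ i, 2 ≤ f i) (hp : ∀ i, 0 < p i)
    (hp1 : ∑ i, p i = 1) {l : Fin η} (hl : 2 ≤ f l - 1) {i₀ : Fin η} (hi₀ : ∀ i, i ≠ i₀ → i₀ < i)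
    {M : ℕ} (hM : ∀ i, f i ≤ M) {r : Fin η → ℝ} (hr : IsOptimal f p r)
    {a : ℝ} (ha : a < objective f r) :
    ∃ C : ℝ, 0 < C ∧ ∃ K : ℝ, 0 < K ∧ ∀ (n : ℕ)
      (Ω : Type u) [MeasurableSpace Ω] (P : Measure Ω) [IsProbabilityMeasure P]
        (d : List ℕ → Ω → ℕ), IsGaltonWatsonDegrees P f p d →
        P.real {ω | Real.log (minPathProduct (fun v => d v ω) (n + 1) : ℝ) ≤ a * (n + 1)} ≤
          K * Real.exp (-C * n) := by
  have hμ := one_lt_sum_childWeight hf2 hp hp1 hl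
  have hμ0 : 0 < meanChildren f p := by rw [← sum_childWeight hf2]; linarith
  have hp' : ∀ i, 0 ≤ p i := fun i => (hp i).le
  have hq := childWeight_pos hf2 hp
  obtain ⟨θ, hθ, hZ⟩ := exists_tilt_lt_one (x := logCost f) (i₀ := i₀) hq hμ.le (fun i => by
      by_cases hi : i = i₀
      · rw [hi]
      · exact (logCost_lt hf hf2 (hi₀ i hi)).le) ha (fun s hs hsE => by
      rw [← objective_eq hf2]
      refine hr.2 ?_
      rw [feasibleSet_eq hf2 hp hμ0]
      exact ⟨hs, hsE⟩)
  set Z := ∑ i, childWeight f p i * Real.exp (θ * (a - logCost f i)) with hZd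
  have hZ0 : 0 < Z :=
    Finset.sum_pos (fun i _ => mul_pos (hq i) (Real.exp_pos _)) ⟨i₀, Finset.mem_univ _⟩
  have hM0 : 0 < M := by have := hf2 i₀; have := hM i₀; omega
  have hM0' : (0 : ℝ) < M := by exact_mod_cast hM0
  refine ⟨-Real.log Z, neg_pos.2 (Real.log_neg hZ0 hZ), M * Real.exp (θ * a), by positivity,
    fun n Ω _ P _ d hd => ?_⟩
  set c := a * ((n : ℝ) + 1) with hc
  set A := costPgf p (fun i => f i - 1) (logCost f) n c 0 with hA
  have hA0 : 0 ≤ A := costPgf_nonneg hp' n c le_rfl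
  have hA1 : A ≤ 1 := costPgf_le_one hp' hp1 n c le_rfl zero_le_one
  have hcompl : {ω | Real.log (minPathProduct (fun v => d v ω) (n + 1) : ℝ) ≤ c} =
      {ω | c < Real.log (minPathProduct (fun v => d v ω) (n + 1) : ℝ)}ᶜ := by
    ext ω
    simp
  rw [hcompl, probReal_compl_eq_one_sub₀
      (hd.nullMeasurableSet_lt_log_minPathProduct hf.injective hf2 hp1 n c),
    hd.measureReal_lt_log_minPathProduct hf.injective hf2 hp1]
  -- A union bound over the at most `M` children of the root, then Markov and Chernoff.
  calc 1 - ∑ i, p i * A ^ f i = ∑ i, p i * (1 - A ^ f i) := by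
        simp only [mul_sub, Finset.sum_sub_distrib, mul_one, hp1]
    _ ≤ ∑ i, p i * (M * (1 - A)) := by
        refine Finset.sum_le_sum fun i _ => mul_le_mul_of_nonneg_left ?_ (hp' i)
        refine (one_sub_pow_le hA0 _).trans (mul_le_mul_of_nonneg_right ?_ (by linarith))
        exact_mod_cast hM i
    _ = M * (1 - A) := by rw [← Finset.sum_mul, hp1, one_mul]
    _ ≤ M * (Real.exp (θ * (c - a * n)) * Z ^ n) :=
        mul_le_mul_of_nonneg_left ((one_sub_costPgf_le_costMean hp' hp1 n c).trans
          (costMean_le_exp hp' hθ a n c)) hM0'.le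
    _ = _ := by
        have e1 : c - a * n = a := by rw [hc]; ring
        have e2 : Real.exp (-(-Real.log Z) * n) = Z ^ n := by
          rw [neg_neg, mul_comm, Real.exp_nat_mul, Real.exp_log hZ0]
        rw [e1, e2]
        ring

/-- Exponential concentration of the logarithm of the extremal product around the optimal value. -/
theorem exists_concentration (hf : StrictMono f) (hf2 : ∀ i, 2 ≤ f i) (hp : ∀ i, 0 < p i)
    (hp1 : ∑ i, p i = 1) {l : Fin η} (hl : 2 ≤ f l - 1) {i₀ : Fin η} (hi₀ : ∀ i, i ≠ i₀ → i₀ < i)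
    {r : Fin η → ℝ} (hr : IsOptimal f p r) {δ : ℝ} (hδ : 0 < δ) :
    ∃ C : ℝ, 0 < C ∧ ∃ C' : ℝ, 0 < C' ∧
      ∀ (Ω : Type u) [MeasurableSpace Ω] (P : Measure Ω) [IsProbabilityMeasure P]
        (d : List ℕ → Ω → ℕ), IsGaltonWatsonDegrees P f p d →
        ∀ T : ℕ, Even T → C' ≤ (T : ℝ) →
          P.real {ω | δ < |Real.log (extremalProduct (fun v => d v ω) (T / 2) : ℝ) / ((T : ℝ) / 2)
            - objective f r|} ≤ Real.exp (-C * T) := by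
  set γ := objective f r with hγ
  have hγ0 : 0 ≤ γ := by
    rw [hγ, objective_eq hf2]
    exact Finset.sum_nonneg fun i _ => mul_nonneg (hr.1.1.1 i) (logCost_nonneg i)
  have hM : ∀ i, f i ≤ ∑ j, f j := fun i =>
    Finset.single_le_sum (fun _ _ => Nat.zero_le _) (Finset.mem_univ i)
  set M := ∑ j, f j with hMd
  -- Only `δ / 2` is used here; the other half absorbs the root factor `log M`.
  obtain ⟨C₁, hC₁, N, hN⟩ := exists_upper_tail.{u} hf hf2 hp hp1 hl hr
    (b := γ + δ / 2) (by linarith)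
  obtain ⟨C₂, hC₂, K, hK, hlow⟩ := exists_lower_tail.{u} hf hf2 hp hp1 hl hi₀ hM hr
    (a := γ - δ) (by linarith)
  set C₀ := min C₁ C₂ with hC₀d
  have hC₀ : 0 < C₀ := lt_min hC₁ hC₂
  -- The second entry gives `log M ≤ δ n / 2`. The third gives `log (1 + K) ≤ C₀ (n - 1) / 2`; since
  -- `T = 2 (n + 1)`, the final exponent is then at most `-C₀ (n + 1) / 2 = -(C₀ / 4) T`.
  set B := max (N : ℝ) (max (2 * Real.log M / δ) (2 * Real.log (1 + K) / C₀ + 1)) with hB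
  have hBN : (N : ℝ) ≤ B := le_max_left _ _
  refine ⟨C₀ / 4, by positivity, 2 * (B + 1), ?_, ?_⟩
  · have : (0 : ℝ) ≤ N := Nat.cast_nonneg N
    linarith
  intro Ω _ P _ d hd T hT hTC
  obtain ⟨m, rfl⟩ := hT
  have hm : B + 1 ≤ m := by push_cast at hTC; linarith
  have hN0 : (0 : ℝ) ≤ N := Nat.cast_nonneg N
  obtain ⟨n, rfl⟩ : ∃ n, m = n + 1 := by
    refine Nat.exists_eq_succ_of_ne_zero fun h => ?_
    rw [h, Nat.cast_zero] at hm
    linarith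
  have hnB : B ≤ n := by push_cast at hm; linarith
  have hNn : N ≤ n := by exact_mod_cast hBN.trans hnB
  have hn1 : 2 * Real.log M / δ ≤ n := ((le_max_left _ _).trans (le_max_right _ _)).trans hnB
  have hn2 : 2 * Real.log (1 + K) / C₀ + 1 ≤ n :=
    ((le_max_right _ _).trans (le_max_right _ _)).trans hnB
  rw [div_le_iff₀ hδ] at hn1
  have hn2' : 2 * Real.log (1 + K) ≤ (n - 1) * C₀ := by
    rw [← div_le_iff₀ hC₀]
    linarith
  have hhalf : (n + 1 + (n + 1)) / 2 = n + 1 := by omega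
  have hhalf' : ((n + 1 + (n + 1) : ℕ) : ℝ) / 2 = n + 1 := by push_cast; ring
  rw [hhalf, hhalf']
  have hn0 : (0 : ℝ) ≤ n := Nat.cast_nonneg n
  have hn10 : (0 : ℝ) < n + 1 := by linarith
  set U := {ω | (γ + δ / 2) * n < Real.log (minPathProduct (fun v => d v ω) (n + 1) : ℝ)} with hU
  set V := {ω | Real.log (minPathProduct (fun v => d v ω) (n + 1) : ℝ) ≤ (γ - δ) * (n + 1)} with hV
  have hsub : {ω | δ < |Real.log (extremalProduct (fun v => d v ω) (n + 1) : ℝ) / ((n : ℝ) + 1)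
      - γ|} ≤ᵐ[P] (U ∪ V : Set Ω) := by
    filter_upwards [hd.ae_log_extremalProduct hf.injective hf2 hp1 hM n] with ω hω
    intro h
    have h : δ < |Real.log (extremalProduct (fun v => d v ω) (n + 1) : ℝ) / ((n : ℝ) + 1) - γ| := h
    rcases lt_abs.1 h with h | h
    · left
      change (γ + δ / 2) * n < Real.log (minPathProduct (fun v => d v ω) (n + 1) : ℝ)
      have h' := lt_sub_iff_add_lt.1 h
      rw [lt_div_iff₀ hn10] at h'
      nlinarith [hω.2]
    · right
      change Real.log (minPathProduct (fun v => d v ω) (n + 1) : ℝ) ≤ (γ - δ) * (n + 1)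
      have h' : Real.log (extremalProduct (fun v => d v ω) (n + 1) : ℝ) / ((n : ℝ) + 1) < γ - δ := by
        linarith
      rw [div_lt_iff₀ hn10] at h'
      linarith [hω.1]
  have hPU : P.real U ≤ Real.exp (-C₀ * n) := by
    refine (hN n hNn Ω P d hd).trans (Real.exp_le_exp.2 ?_)
    nlinarith [min_le_left C₁ C₂]
  have hPV : P.real V ≤ K * Real.exp (-C₀ * n) := by
    refine (hlow n Ω P d hd).trans (mul_le_mul_of_nonneg_left (Real.exp_le_exp.2 ?_) hK.le)
    nlinarith [min_le_right C₁ C₂]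
  calc _ ≤ P.real (U ∪ V) :=
        ENNReal.toReal_mono (measure_ne_top _ _) (measure_mono_ae hsub)
    _ ≤ P.real U + P.real V := measureReal_union_le _ _
    _ ≤ (1 + K) * Real.exp (-C₀ * n) := by linarith
    _ = Real.exp (Real.log (1 + K) - C₀ * n) := by
        rw [sub_eq_add_neg, Real.exp_add, Real.exp_log (by linarith), neg_mul]
    _ ≤ _ := by
        refine Real.exp_le_exp.2 ?_
        push_cast
        nlinarith

end Concentration

theorem theorem3 (η : ℕ) (hη : 2 ≤ η) (f : Fin η → ℕ) (p : Fin η → ℝ)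
    (hf : StrictMono f) (hf2 : ∀ i, 2 ≤ f i) (hp : ∀ i, 0 < p i) (hp1 : ∑ i, p i = 1) :
    (1 < p ⟨0, by omega⟩ * ((f ⟨0, by omega⟩ : ℝ) - 1) →
      ∀ δ : ℝ, 0 < δ → ∃ C : ℝ, 0 < C ∧ ∃ C' : ℝ, 0 < C' ∧
        ∀ (Ω : Type u) [MeasurableSpace Ω] (P : Measure Ω) [IsProbabilityMeasure P]
          (d : List ℕ → Ω → ℕ), IsGaltonWatsonDegrees P f p d →
          ∀ T : ℕ, Even T → C' ≤ (T : ℝ) →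
            P.real {ω | δ < |Real.log (extremalProduct (fun v => d v ω) (T / 2) : ℝ) / ((T : ℝ) / 2)
              - Real.log ((f ⟨0, by omega⟩ : ℝ) - 1)|} ≤ Real.exp (-C * T)) ∧
    (p ⟨0, by omega⟩ * ((f ⟨0, by omega⟩ : ℝ) - 1) ≤ 1 →
      (∃! r, IsOptimal f p r) ∧
      ∀ r, IsOptimal f p r →
      ∀ δ : ℝ, 0 < δ → ∃ C : ℝ, 0 < C ∧ ∃ C' : ℝ, 0 < C' ∧
        ∀ (Ω : Type u) [MeasurableSpace Ω] (P : Measure Ω) [IsProbabilityMeasure P]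
          (d : List ℕ → Ω → ℕ), IsGaltonWatsonDegrees P f p d →
          ∀ T : ℕ, Even T → C' ≤ (T : ℝ) →
            P.real {ω | δ < |Real.log (extremalProduct (fun v => d v ω) (T / 2) : ℝ) / ((T : ℝ) / 2)
              - objective f r|} ≤ Real.exp (-C * T)) := by
  have hi₀ : ∀ i : Fin η, i ≠ ⟨0, by omega⟩ → (⟨0, by omega⟩ : Fin η) < i := fun i hi =>
    Fin.mk_lt_of_lt_val (Nat.pos_of_ne_zero fun h => hi (Fin.ext h))
  -- The second smallest degree is at least `3`: this type branches, and it makes `μ_D > 1`.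
  have hl : 2 ≤ f ⟨1, by omega⟩ - 1 := by
    have h1 := hf2 ⟨0, by omega⟩
    have h2 : f ⟨0, by omega⟩ < f ⟨1, by omega⟩ := hf (Fin.mk_lt_mk.2 one_pos)
    omega
  have hμ : 1 < meanChildren f p := by
    rw [← sum_childWeight hf2]
    exact one_lt_sum_childWeight hf2 hp hp1 hl
  refine ⟨fun h δ hδ => ?_, fun _ => ⟨existsUnique_isOptimal hf hf2 hp hμ hi₀, fun r hr δ hδ =>
    exists_concentration.{u} hf hf2 hp hp1 hl hi₀ hr hδ⟩⟩
  rw [← objective_single]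
  exact exists_concentration.{u} hf hf2 hp hp1 hl hi₀
    (isOptimal_single hf hf2 hp (by linarith) hi₀ h.le) hδ
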